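/- **Notation.** For $k\ge 1$ and $\mu\in\mathbb C$ let $J_k(\mu)$ be the $k\times k$ upper triangular Jordan block with eigenvalue $\mu$, let $\Gamma_k$ be the $k\times k$ matrix whose $(i,j)$ entry is $(-1)^{k-i}$ if $i+j\in\{k+1,k+2\}$ and $0$ otherwise (so $\Gamma_1=1$), and let $H_{2k}(\mu)=\begin{bmatrix}0&I_k\\ J_k(\mu)&0\end{bmatrix}$. Closures are taken in the standard topology of $\mathbb C^{n\times n}$. Call $\mu\in\mathbb C$ *admissible* if $|\mu|>1$ or $\mu=e^{\mathrm i\theta}$ with $0<\theta<\pi$. Every $A\in\mathbb C^{n\times n}$ is congruent to a direct sum, unique up to permutation of summands, $$\bigoplus_{j=1}^{n_1}J_{k_j}(0)\oplus\bigoplus_{j=1}^{n_2}\Gamma_{\ell_j}\oplus\bigoplus_{j=1}^{n_3}H_{2m_j}(\mu_j)\oplus\bigoplus_{j=1}^{n_4}H_{2p_j}((-1)^{p_j}),\qquad \mu_j \text{ admissible}.$$ The *congruence bundle* $\mathcal B^c(A)$ is the set of all matrices $$P\Big(\bigoplus_{j=1}^{n_1} J_{k_j}(0)\oplus\bigoplus_{j=1}^{n_2}\Gamma_{\ell_j}\oplus\bigoplus_{j=1}^{n_3}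 H_{2m_j}(\widetilde\mu_j)\oplus\bigoplus_{j=1}^{n_4} H_{2p_j}((-1)^{p_j})\Big)P^\top$$ with $P\in\mathbb C^{n\times n}$ invertible, all $\widetilde\mu_j$ admissible, and $\widetilde\mu_i\ne\widetilde\mu_j\Leftrightarrow\mu_i\ne\mu_j$. Every $A\in\mathbb C^{n\times n}$ is $^*$congruent to a direct sum, unique up to permutation of summands, $$\bigoplus_{i=1}^{n_1}J_{k_i}(0)\oplus\bigoplus_{i=1}^{n_2}\alpha_i\Gamma_{\ell_i}\oplus\bigoplus_{i=1}^{n_3}H_{2m_i}(\mu_i),\qquad |\alpha_i|=1,\ |\mu_i|>1.$$ The *$^*$congruence bundle* $\mathcal B^*(A)$ is the set of all matrices $$P\Big(\bigoplus_{i=1}^{n_1} J_{k_i}(0)\oplus\bigoplus_{i=1}^{n_2}\widetilde\alpha_i\Gamma_{\ell_i}\oplus\bigoplus_{i=1}^{n_3} H_{2m_i}(\widetilde\mu_i)\Big)P^*$$ with $P\in\mathbb C^{n\times n}$ invertible, $|\widetilde\alpha_i|=1$, $|\widetilde\mu_i|>1$, $\widetilde\mu_i\ne\widetilde\mu_j\Leftrightarrow\mu_i\ne\mu_j$,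 and, for all $i,j$, $\widetilde\alpha_i^2\ne\widetilde\alpha_j^2\Leftrightarrow\alpha_i^2\ne\alpha_j^2$ if $\ell_i\equiv\ell_j \pmod 2$, and $\widetilde\alpha_i^2\ne-\widetilde\alpha_j^2\Leftrightarrow\alpha_i^2\ne-\alpha_j^2$ if $\ell_i\not\equiv\ell_j\pmod 2$. **Theorem.** Let $n\ge1$. (a) Let $\mu_1,\dots,\mu_{\lfloor n/2\rfloor}$ be distinct admissible numbers, and let $$\mathcal G:=\mathcal B^c\Big(\bigoplus_{i=1}^{n/2}H_2(\mu_i)\Big)\ (n\text{ even}),\qquad \mathcal G:=\mathcal B^c\Big(\bigoplus_{i=1}^{\lfloor n/2\rfloor}H_2(\mu_i)\oplus1\Big)\ (n\text{ odd}).$$ Then $\mathcal G$ does not depend on the choice of the $\mu_i$, and $\overline{\mathcal G}=\mathbb C^{n\times n}$. (b) For $\ell=0,1,\dots,\lfloor n/2\rfloor$ let $$\mathcal G_\ell:=\mathcal B^*\Big(\bigoplus_{i=1}^{\ell}H_2(\mu_i)\oplus\bigoplus_{j=1}^{n-2\ell}\alpha_j\Big),$$ where $|\mu_i|>1$ and the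 $\mu_i$ are distinct, and $|\alpha_j|=1$ and the $\alpha_j^2$ are distinct (the parameters may be chosen separately for each $\ell$). Then $\mathcal G_\ell$ does not depend on the choice of the parameters, and (b1) $\mathbb C^{n\times n}=\bigcup_{\ell=0}^{\lfloor n/2\rfloor}\overline{\mathcal G_\ell}$; (b2) $\overline{\mathcal G_{\ell_1}}\cap\mathcal G_{\ell_2}=\emptyset$ whenever $0\le\ell_1\ne\ell_2\le\lfloor n/2\rfloor$. In particular, the $\lfloor n/2\rfloor+1$ closures $\overline{\mathcal G_\ell}$ are pairwise different. -/

import Mathlib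

open Matrix

noncomputable section

namespace CongruenceCFC

/-! ### Building blocks and direct sums -/

/-- The upper triangular Jordan block `J_k(μ)`. -/
def jordanBlock (k : ℕ) (μ : ℂ) : Matrix (Fin k) (Fin k) ℂ :=
  Matrix.of fun i j =>
    if (i : ℕ) = j then μ else if (i : ℕ) + 1 = j then 1 else 0

/-- The matrix `Γ_k`. Numbering rows and columns from `1`, its nonzero entries are those at the
positions `(i, j)` with `i + j = k + 1` or `i + j = k + 2`, and the nonzero entries of row `i` are
equal to `(-1)^(k - i)`; below, rows and columns are numbered from `0`. -/
def gammaBlock (k : ℕ) : Matrix (Fin k) (Fin k) ℂ :=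
  Matrix.of fun i j =>
    if (i : ℕ) + j + 1 = k ∨ (i : ℕ) + j = k then (-1) ^ (k + 1 + (i : ℕ)) else 0

/-- The `2k × 2k` matrix `H_{2k}(μ) = [0, I_k; J_k(μ), 0]`. -/
def hBlock (k : ℕ) (μ : ℂ) : Matrix (Fin k ⊕ Fin k) (Fin k ⊕ Fin k) ℂ :=
  Matrix.fromBlocks 0 1 (jordanBlock k μ) 0

/-- The direct sum of two square matrices. -/
def dsum {m k : Type*} (A : Matrix m m ℂ) (B : Matrix k k ℂ) : Matrix (m ⊕ k) (m ⊕ k) ℂ :=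
  Matrix.fromBlocks A 0 0 B

/-! ### Congruence and `*`congruence

The two matrices may be indexed by different types of the same cardinality. The bijection `e` only
permutes rows and columns simultaneously, which is itself a congruence by a permutation matrix. -/

/-- `A = P B Pᵀ` for some invertible `P`. -/
def Congruent {m k : Type*} [Fintype m] [DecidableEq m]
    (A : Matrix m m ℂ) (B : Matrix k k ℂ) : Prop :=
  ∃ (e : m ≃ k) (P : Matrix m m ℂ), IsUnit P ∧ A = P * B.submatrix e e * Pᵀ

/-- `A = P B P*` for some invertible `P`. -/
def StarCongruent {m k : Type*} [Fintype m] [DecidableEq m]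
    (A : Matrix m m ℂ) (B : Matrix k k ℂ) : Prop :=
  ∃ (e : m ≃ k) (P : Matrix m m ℂ), IsUnit P ∧ A = P * B.submatrix e e * Pᴴ

/-! ### Canonical forms and bundles for congruence -/

/-- The parameters `μ` allowed in the blocks of type II-(a) of the canonical form for congruence:
`|μ| > 1`, or `μ = exp(iθ)` with `0 < θ < π`. -/
def CongruenceParam (μ : ℂ) : Prop :=
  1 < ‖μ‖ ∨ ∃ θ : ℝ, 0 < θ ∧ θ < Real.pi ∧ μ = Complex.exp (θ * Complex.I)

/-- The numbers and the sizes of the blocks of each type in a canonical form for congruence. -/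
structure CongruenceShape where
  n₁ : ℕ
  n₂ : ℕ
  n₃ : ℕ
  n₄ : ℕ
  k : Fin n₁ → ℕ
  l : Fin n₂ → ℕ
  m : Fin n₃ → ℕ
  p : Fin n₄ → ℕ
  k_pos : ∀ j, 0 < k j
  l_pos : ∀ j, 0 < l j
  m_pos : ∀ j, 0 < m j
  p_pos : ∀ j, 0 < p j

/-- The index type of the rows and columns of a canonical form of the given shape. -/
abbrev CongruenceShape.Idx (S : CongruenceShape) : Type :=
  ((Σ j : Fin S.n₁, Fin (S.k j)) ⊕ (Σ j : Fin S.n₂, Fin (S.l j))) ⊕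
    ((Σ j : Fin S.n₃, Fin (S.m j) ⊕ Fin (S.m j)) ⊕ (Σ j : Fin S.n₄, Fin (S.p j) ⊕ Fin (S.p j)))

/-- The canonical form
`⨁ J_{k_j}(0) ⊕ ⨁ Γ_{l_j} ⊕ ⨁ H_{2 m_j}(μ_j) ⊕ ⨁ H_{2 p_j}((-1)^{p_j})`. -/
def CongruenceShape.form (S : CongruenceShape) (μ : Fin S.n₃ → ℂ) : Matrix S.Idx S.Idx ℂ :=
  dsum
    (dsum (Matrix.blockDiagonal' fun j => jordanBlock (S.k j) 0)
      (Matrix.blockDiagonal' fun j => gammaBlock (S.l j)))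
    (dsum (Matrix.blockDiagonal' fun j => hBlock (S.m j) (μ j))
      (Matrix.blockDiagonal' fun j => hBlock (S.p j) ((-1) ^ S.p j)))

/-- The congruence bundle of `A`: the matrices whose canonical form for congruence is that of `A`
up to the values of the parameters `μ_j`, which remain distinct or equal as they are in `A`. -/
def congruenceBundle {n : ℕ} (A : Matrix (Fin n) (Fin n) ℂ) :
    Set (Matrix (Fin n) (Fin n) ℂ) :=
  {B | ∃ (S : CongruenceShape) (μ : Fin S.n₃ → ℂ),
    (∀ j, CongruenceParam (μ j)) ∧ Congruent A (S.form μ) ∧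
    ∃ μ' : Fin S.n₃ → ℂ,
      (∀ j, CongruenceParam (μ' j)) ∧ (∀ i j, μ' i ≠ μ' j ↔ μ i ≠ μ j) ∧
      Congruent B (S.form μ')}

/-! ### Canonical forms and bundles for `*`congruence -/

/-- The numbers and the sizes of the blocks of each type in a canonical form for `*`congruence. -/
structure StarShape where
  n₁ : ℕ
  n₂ : ℕ
  n₃ : ℕ
  k : Fin n₁ → ℕ
  l : Fin n₂ → ℕ
  m : Fin n₃ → ℕ
  k_pos : ∀ j, 0 < k j
  l_pos : ∀ j, 0 < l j
  m_pos : ∀ j, 0 < m j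

/-- The index type of the rows and columns of a canonical form of the given shape. -/
abbrev StarShape.Idx (S : StarShape) : Type :=
  ((Σ j : Fin S.n₁, Fin (S.k j)) ⊕ (Σ j : Fin S.n₂, Fin (S.l j))) ⊕
    (Σ j : Fin S.n₃, Fin (S.m j) ⊕ Fin (S.m j))

/-- The canonical form `⨁ J_{k_j}(0) ⊕ ⨁ α_j Γ_{l_j} ⊕ ⨁ H_{2 m_j}(μ_j)`. -/
def StarShape.form (S : StarShape) (α : Fin S.n₂ → ℂ) (μ : Fin S.n₃ → ℂ) :
    Matrix S.Idx S.Idx ℂ :=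
  dsum
    (dsum (Matrix.blockDiagonal' fun j => jordanBlock (S.k j) 0)
      (Matrix.blockDiagonal' fun j => α j • gammaBlock (S.l j)))
    (Matrix.blockDiagonal' fun j => hBlock (S.m j) (μ j))

/-- The `*`congruence bundle of `A`: the matrices whose canonical form for `*`congruence is that of
`A` up to the values of the parameters `α_j`, `μ_j`, which satisfy the same inequalities as in
`A`. -/
def starCongruenceBundle {n : ℕ} (A : Matrix (Fin n) (Fin n) ℂ) :
    Set (Matrix (Fin n) (Fin n) ℂ) :=
  {B | ∃ (S : StarShape) (α : Fin S.n₂ → ℂ) (μ : Fin S.n₃ → ℂ),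
    (∀ j, ‖α j‖ = 1) ∧ (∀ j, 1 < ‖μ j‖) ∧ StarCongruent A (S.form α μ) ∧
    ∃ (α' : Fin S.n₂ → ℂ) (μ' : Fin S.n₃ → ℂ),
      (∀ j, ‖α' j‖ = 1) ∧ (∀ j, 1 < ‖μ' j‖) ∧
      (∀ i j, S.l i % 2 = S.l j % 2 → (α' i ^ 2 ≠ α' j ^ 2 ↔ α i ^ 2 ≠ α j ^ 2)) ∧
      (∀ i j, S.l i % 2 ≠ S.l j % 2 → (α' i ^ 2 ≠ -α' j ^ 2 ↔ α i ^ 2 ≠ -α j ^ 2)) ∧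
      (∀ i j, μ' i ≠ μ' j ↔ μ i ≠ μ j) ∧
      StarCongruent B (S.form α' μ')}

/-! ### The generating matrices of the generic bundles -/

/-- The order-preserving splitting of the `n` indices into `ℓ` consecutive pairs followed by
`n - 2ℓ` single indices. -/
def genericEquiv (n ℓ : ℕ) (h : ℓ ≤ n / 2) :
    Fin n ≃ (Σ _ : Fin ℓ, Fin 1 ⊕ Fin 1) ⊕ Fin (n - 2 * ℓ) :=
  (finCongr (show n = ℓ * (1 + 1) + (n - 2 * ℓ) by omega)).trans
    (finSumFinEquiv.symm.trans
      (Equiv.sumCongr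
        (finProdFinEquiv.symm.trans
          ((Equiv.prodCongr (Equiv.refl (Fin ℓ)) finSumFinEquiv.symm).trans
            (Equiv.sigmaEquivProd (Fin ℓ) (Fin 1 ⊕ Fin 1)).symm))
        (Equiv.refl (Fin (n - 2 * ℓ)))))

/-- The `n × n` matrix `H_2(μ_1) ⊕ ⋯ ⊕ H_2(μ_ℓ) ⊕ α_1 ⊕ ⋯ ⊕ α_{n-2ℓ}`. -/
def genericMatrix (n ℓ : ℕ) (h : ℓ ≤ n / 2) (μ : Fin ℓ → ℂ) (α : Fin (n - 2 * ℓ) → ℂ) :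
    Matrix (Fin n) (Fin n) ℂ :=
  (dsum (Matrix.blockDiagonal' fun i => hBlock 1 (μ i)) (Matrix.diagonal α)).submatrix
    (genericEquiv n ℓ h) (genericEquiv n ℓ h)

/-- The congruence bundle of `H_2(μ_1) ⊕ ⋯ ⊕ H_2(μ_{n/2})` if `n` is even, and of
`H_2(μ_1) ⊕ ⋯ ⊕ H_2(μ_{⌊n/2⌋}) ⊕ 1` if `n` is odd (`n - 2⌊n/2⌋` is `0` or `1`). -/
def genericBundle (n : ℕ) (μ : Fin (n / 2) → ℂ) : Set (Matrix (Fin n) (Fin n) ℂ) :=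
  congruenceBundle (genericMatrix n (n / 2) le_rfl μ fun _ => 1)

/-- The `*`congruence bundle of `H_2(μ_1) ⊕ ⋯ ⊕ H_2(μ_ℓ) ⊕ α_1 ⊕ ⋯ ⊕ α_{n-2ℓ}`, for
`0 ≤ ℓ ≤ ⌊n/2⌋`. -/
def genericStarBundle (n : ℕ) (ℓ : Fin (n / 2 + 1)) (μ : Fin (ℓ : ℕ) → ℂ)
    (α : Fin (n - 2 * (ℓ : ℕ)) → ℂ) : Set (Matrix (Fin n) (Fin n) ℂ) :=
  starCongruenceBundle (genericMatrix n ℓ (Nat.lt_succ_iff.mp ℓ.isLt) μ α)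

/-- The conditions on the parameters in the generic congruence bundle. -/
def GenericParams {ℓ : ℕ} (μ : Fin ℓ → ℂ) : Prop :=
  (∀ i, CongruenceParam (μ i)) ∧ ∀ i i', i ≠ i' → μ i ≠ μ i'

/-- The conditions on the parameters in the generic `*`congruence bundles. -/
def GenericStarParams {ℓ t : ℕ} (μ : Fin ℓ → ℂ) (α : Fin t → ℂ) : Prop :=
  (∀ i, 1 < ‖μ i‖) ∧ (∀ i i', i ≠ i' → μ i ≠ μ i') ∧
    (∀ j, ‖α j‖ = 1) ∧ ∀ j j', j ≠ j' → α j ^ 2 ≠ α j' ^ 2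

end CongruenceCFC

end

open Matrix

noncomputable section

namespace CongruenceCFC

/-! ### Twisted transposes and pencils

Congruence and `*`congruence are treated together: `τ` is the identity or complex conjugation. -/

/-! Every generic bundle turns out to be a set defined by the spectrum of the pencil `A - z A^τ`,
where `τ` is the identity for congruence and conjugation for `*`congruence. The zeros of its
determinant are invariant under (`*`)congruence. Call the spectrum simple if `A` is invertible and
there are `n` distinct zeros. Then `𝒢` is the set of matrices with simple spectrum, and `𝒢_ℓ` is the
set of those with exactly `2ℓ` zeros off the unit circle (`genericBundle_eq`,
`genericStarBundle_eq`). Independence of the parameters is then immediate.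

In one direction, a block `Γ_l` has one zero and a block `H_{2m}` at most two, so `n` distinct zeros
force minimal blocks and distinct parameters. This applies to any canonical form of the given
matrix, so uniqueness of canonical forms is not needed. In the other direction
(`HasSimpleSpectrum.exists_twistCongruent`), let `V` be a basis of eigenvectors. Then `M = V^τ B V`
satisfies `M = M^τ Λ`, hence `M i j ≠ 0` only if `λ_j τ(λ_i) = 1`. So `M` has one nonzero entry per
row: the 2-cycles of `λ ↦ τ(λ)⁻¹` give blocks `H_2`, its fixed points give `1 × 1` blocks.

Density (`closure_hasSimpleSpectrum`): on the real line joining any matrix to one with simple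
spectrum, failure of simplicity is the vanishing of a nonzero polynomial. For `*`congruence the
spectrum is symmetric in the unit circle, so a simple zero on the circle cannot leave it under a
small perturbation. Hence the strata are open (`isOpen_simpleSpectrumStratum`); being disjoint, each
avoids the closures of the others. -/

/-- The transpose of `A` with `τ` applied to the entries. -/
def twistTranspose (τ : ℂ →+* ℂ) {m k : Type*} (A : Matrix m k ℂ) : Matrix k m ℂ :=
  (A.map τ)ᵀ

/-- `A = P B P^τ` for some invertible `P`, where `P^τ` is the twisted transpose of `P`. -/
def TwistCongruent (τ : ℂ →+* ℂ) {m k : Type*} [Fintype m] [DecidableEq m]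
    (A : Matrix m m ℂ) (B : Matrix k k ℂ) : Prop :=
  ∃ (e : m ≃ k) (P : Matrix m m ℂ), IsUnit P ∧ A = P * B.submatrix e e * twistTranspose τ P

/-- The value at `z` of the pencil `A - z A^τ`. -/
def pencil (τ : ℂ →+* ℂ) {m : Type*} (A : Matrix m m ℂ) (z : ℂ) : Matrix m m ℂ :=
  A - z • twistTranspose τ A

theorem congruent_iff_twistCongruent {m k : Type*} [Fintype m] [DecidableEq m]
    {A : Matrix m m ℂ} {B : Matrix k k ℂ} :
    Congruent A B ↔ TwistCongruent (RingHom.id ℂ) A B := Iff.rfl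

theorem starCongruent_iff_twistCongruent {m k : Type*} [Fintype m] [DecidableEq m]
    {A : Matrix m m ℂ} {B : Matrix k k ℂ} :
    StarCongruent A B ↔ TwistCongruent (starRingEnd ℂ) A B := Iff.rfl

section Twist

variable {τ : ℂ →+* ℂ} {m k : Type*}

@[simp]
theorem twistTranspose_apply (A : Matrix m k ℂ) (i : k) (j : m) :
    twistTranspose τ A i j = τ (A j i) := rfl

theorem twistTranspose_mul {o : Type*} [Fintype k] (A : Matrix m k ℂ) (B : Matrix k o ℂ) :
    twistTranspose τ (A * B) = twistTranspose τ B * twistTranspose τ A := by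
  simp [twistTranspose, Matrix.map_mul, Matrix.transpose_mul]

theorem twistTranspose_twistTranspose (hτ : ∀ x, τ (τ x) = x) (A : Matrix m k ℂ) :
    twistTranspose τ (twistTranspose τ A) = A := by
  ext i j
  simp [hτ]

theorem twistTranspose_one [DecidableEq m] :
    twistTranspose τ (1 : Matrix m m ℂ) = 1 := by
  simp [twistTranspose]

theorem det_twistTranspose [Fintype m] [DecidableEq m] (A : Matrix m m ℂ) :
    (twistTranspose τ A).det = τ A.det := by
  rw [twistTranspose, det_transpose, RingHom.map_det]
  rfl

theorem pencil_zero (A : Matrix m m ℂ) : pencil τ A 0 = A := by simp [pencil]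

theorem pencil_apply (A : Matrix m m ℂ) (z : ℂ) (i j : m) :
    pencil τ A z i j = A i j - z * τ (A j i) := by
  simp [pencil]

theorem pencil_submatrix (A : Matrix m m ℂ) (e : k → m) (z : ℂ) :
    pencil τ (A.submatrix e e) z = (pencil τ A z).submatrix e e := by
  ext i j
  simp [pencil_apply]

theorem pencil_mul_mul [Fintype m] [DecidableEq m] (hτ : ∀ x, τ (τ x) = x)
    (P A : Matrix m m ℂ) (z : ℂ) :
    pencil τ (P * A * twistTranspose τ P) z = P * pencil τ A z * twistTranspose τ P := by
  simp only [pencil, twistTranspose_mul, twistTranspose_twistTranspose hτ]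
  simp [Matrix.mul_sub, Matrix.sub_mul, Matrix.mul_assoc]

/-- The pencil undergoes the same congruence as the matrix, because `τ` is an involution; its
determinant is multiplied by `det P * τ (det P) ≠ 0`. -/
theorem TwistCongruent.det_pencil_eq_zero_iff [Fintype m] [DecidableEq m] [Fintype k]
    [DecidableEq k] (hτ : ∀ x, τ (τ x) = x) {A : Matrix m m ℂ} {B : Matrix k k ℂ}
    (h : TwistCongruent τ A B) (z : ℂ) : (pencil τ A z).det = 0 ↔ (pencil τ B z).det = 0 := by
  obtain ⟨e, P, hP, rfl⟩ := h
  have hd : P.det ≠ 0 := ((Matrix.isUnit_iff_isUnit_det P).1 hP).ne_zero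
  rw [pencil_mul_mul hτ, det_mul, det_mul, det_twistTranspose, pencil_submatrix,
    det_submatrix_equiv_self]
  simp [hd]

theorem pencil_dsum (A : Matrix m m ℂ) (B : Matrix k k ℂ) (z : ℂ) :
    pencil τ (dsum A B) z = dsum (pencil τ A z) (pencil τ B z) := by
  ext (i | i) (j | j) <;> simp [pencil_apply, dsum]

theorem det_pencil_dsum [Fintype m] [DecidableEq m] [Fintype k] [DecidableEq k]
    (A : Matrix m m ℂ) (B : Matrix k k ℂ) (z : ℂ) :
    (pencil τ (dsum A B) z).det = (pencil τ A z).det * (pencil τ B z).det := by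
  rw [pencil_dsum, dsum, det_fromBlocks_zero₂₁]

end Twist

section BlockDiagonal

variable {o : Type*} [Fintype o] [DecidableEq o] {m' : o → Type*} [∀ i, Fintype (m' i)]

theorem blockDiagonal'_mulVec_apply (D : ∀ i, Matrix (m' i) (m' i) ℂ) (v : (Σ i, m' i) → ℂ)
    (j : o) (x : m' j) :
    (blockDiagonal' D *ᵥ v) ⟨j, x⟩ = (D j *ᵥ fun y => v ⟨j, y⟩) x := by
  simp only [mulVec, dotProduct, Fintype.sum_sigma]
  rw [Finset.sum_eq_single j]
  · simp [blockDiagonal'_apply_eq]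
  · intro b _ hb
    exact Finset.sum_eq_zero fun y _ => by
      rw [blockDiagonal'_apply_ne _ _ _ (Ne.symm hb), zero_mul]
  · simp

variable [∀ i, DecidableEq (m' i)]

/-- A kernel vector restricts to a kernel vector of any block on which it is nonzero, and a kernel
vector of a block extends by zero. -/
theorem det_blockDiagonal'_eq_zero_iff (D : ∀ i, Matrix (m' i) (m' i) ℂ) :
    (blockDiagonal' D).det = 0 ↔ ∃ i, (D i).det = 0 := by
  constructor
  · intro h
    obtain ⟨v, hv, hDv⟩ := exists_mulVec_eq_zero_iff.2 h
    obtain ⟨⟨j, x⟩, hx⟩ := Function.ne_iff.1 hv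
    refine ⟨j, exists_mulVec_eq_zero_iff.1 ⟨fun y => v ⟨j, y⟩, Function.ne_iff.2 ⟨x, hx⟩, ?_⟩⟩
    ext y
    rw [← blockDiagonal'_mulVec_apply, hDv]
    rfl
  · rintro ⟨j, hj⟩
    obtain ⟨v, hv, hDv⟩ := exists_mulVec_eq_zero_iff.2 hj
    obtain ⟨x, hx⟩ := Function.ne_iff.1 hv
    refine exists_mulVec_eq_zero_iff.1
      ⟨fun p => if h : p.1 = j then v (h ▸ p.2) else 0, Function.ne_iff.2 ⟨⟨j, x⟩, by simpa⟩, ?_⟩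
    ext ⟨i, y⟩
    rw [blockDiagonal'_mulVec_apply]
    by_cases h : i = j
    · subst h
      simpa using congrFun hDv y
    · simp [h, mulVec, dotProduct]

theorem det_pencil_blockDiagonal'_eq_zero_iff {τ : ℂ →+* ℂ} (D : ∀ i, Matrix (m' i) (m' i) ℂ)
    (z : ℂ) : (pencil τ (blockDiagonal' D) z).det = 0 ↔ ∃ i, (pencil τ (D i) z).det = 0 := by
  have : pencil τ (blockDiagonal' D) z = blockDiagonal' fun i => pencil τ (D i) z := by
    ext ⟨i, x⟩ ⟨j, y⟩
    rw [pencil_apply]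
    by_cases h : i = j
    · subst h
      simp [blockDiagonal'_apply_eq, pencil_apply]
    · simp [blockDiagonal'_apply_ne _ _ _ h, blockDiagonal'_apply_ne _ _ _ (Ne.symm h)]
  rw [this, det_blockDiagonal'_eq_zero_iff]

end BlockDiagonal

/-! ### The spectra of the building blocks -/

section Blocks

variable {τ : ℂ →+* ℂ}

theorem det_jordanBlock (k : ℕ) (μ : ℂ) : (jordanBlock k μ).det = μ ^ k := by
  rw [det_of_isUpperTriangular]
  · simp [jordanBlock]
  · intro i j hij
    have h : (j : ℕ) < i := hij
    simp [jordanBlock, show ¬ (i : ℕ) = j by omega, show ¬ (i : ℕ) + 1 = j by omega]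

theorem det_pencil_jordanBlock_zero_zero {k : ℕ} (hk : 0 < k) :
    (pencil τ (jordanBlock k 0) 0).det = 0 := by
  rw [pencil_zero, det_jordanBlock, zero_pow hk.ne']

theorem det_fromBlocks_antidiagonal_eq_zero_iff {m : Type*} [Fintype m] [DecidableEq m]
    (A B : Matrix m m ℂ) : (fromBlocks 0 A B 0).det = 0 ↔ A.det = 0 ∨ B.det = 0 := by
  have h1 : fromBlocks 0 A B 0 * fromBlocks 0 1 1 0 = fromBlocks A 0 0 B := by
    simp [fromBlocks_multiply]
  have h2 : (fromBlocks 0 1 1 0 : Matrix (m ⊕ m) (m ⊕ m) ℂ) * fromBlocks 0 1 1 0 = 1 := by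
    simp [fromBlocks_multiply]
  have h3 : (fromBlocks 0 1 1 0 : Matrix (m ⊕ m) (m ⊕ m) ℂ).det ≠ 0 := by
    intro h
    simpa [h] using congrArg det h2
  have h4 := congrArg det h1
  rw [det_mul, det_fromBlocks_zero₂₁] at h4
  rw [← mul_eq_zero, ← h4, mul_eq_zero, or_iff_left h3]

/-- The pencil is block antidiagonal with triangular blocks. Whatever its size, the block
contributes at most two distinct zeros. -/
theorem det_pencil_hBlock_eq_zero_iff {k : ℕ} (hk : 0 < k) (μ z : ℂ) :
    (pencil τ (hBlock k μ) z).det = 0 ↔ z = μ ∨ z * τ μ = 1 := by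
  have h : pencil τ (hBlock k μ) z =
      fromBlocks 0 (1 - z • twistTranspose τ (jordanBlock k μ)) (jordanBlock k μ - z • 1) 0 := by
    ext (i | i) (j | j) <;> simp [pencil_apply, hBlock, Matrix.one_apply, eq_comm, apply_ite τ]
  have h1 : (1 - z • twistTranspose τ (jordanBlock k μ)).det = (1 - z * τ μ) ^ k := by
    rw [det_of_isLowerTriangular]
    · simp [jordanBlock]
    · intro i j hij
      have h : (i : ℕ) < j := hij
      have h' : i ≠ j := fun e => by simp [e] at h
      simp [jordanBlock, h', show ¬ (j : ℕ) = i by omega, show ¬ (j : ℕ) + 1 = i by omega]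
  have h2 : (jordanBlock k μ - z • (1 : Matrix (Fin k) (Fin k) ℂ)).det = (μ - z) ^ k := by
    rw [det_of_isUpperTriangular]
    · simp [jordanBlock]
    · intro i j hij
      have h : (j : ℕ) < i := hij
      have h' : i ≠ j := fun e => by simp [e] at h
      simp [jordanBlock, h', show ¬ (i : ℕ) = j by omega, show ¬ (i : ℕ) + 1 = j by omega]
  rw [h, det_fromBlocks_antidiagonal_eq_zero_iff, h1, h2, pow_eq_zero_iff hk.ne',
    pow_eq_zero_iff hk.ne', sub_eq_zero, sub_eq_zero, or_comm, eq_comm, @eq_comm _ (1 : ℂ)]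

/-- Reversing the rows makes the pencil triangular, with diagonal entries equal up to sign; hence a
single condition on `z`, whatever the size. -/
theorem det_pencil_smul_gammaBlock_eq_zero_iff {k : ℕ} (hk : 0 < k) (α z : ℂ) :
    (pencil τ (α • gammaBlock k) z).det = 0 ↔ α = z * τ α * (-1) ^ (k + 1) := by
  have h1 : (pencil τ (α • gammaBlock k) z).det = 0 ↔
      ((pencil τ (α • gammaBlock k) z).submatrix Fin.revPerm id).det = 0 := by
    rw [det_permute]
    simp
  rw [h1, det_of_isUpperTriangular]
  · have hent : ∀ i : Fin k, (pencil τ (α • gammaBlock k) z).submatrix Fin.revPerm id i i =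
        (-1) ^ (i : ℕ) * (α - z * τ α * (-1) ^ (k + 1)) := by
      intro i
      have hi := i.isLt
      have e1 : (-1 : ℂ) ^ (k + 1 + (k - (i + 1))) = (-1) ^ (i : ℕ) := by
        rw [show k + 1 + (k - (i + 1)) = 2 * (k - i) + i by omega, pow_add, pow_mul]
        simp
      rw [submatrix_apply, pencil_apply]
      simp [gammaBlock, Fin.val_rev, show k - ((i : ℕ) + 1) + i + 1 = k by omega,
        show (i : ℕ) + (k - ((i : ℕ) + 1)) + 1 = k by omega, e1]
      ring
    rw [Finset.prod_congr rfl fun i _ => hent i, Finset.prod_eq_zero_iff]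
    constructor
    · rintro ⟨i, _, hi⟩
      have := (mul_eq_zero.1 hi).resolve_left (by simp)
      exact sub_eq_zero.1 this
    · intro h
      exact ⟨⟨0, hk⟩, Finset.mem_univ _, by rw [sub_eq_zero.2 h, mul_zero]⟩
  · intro i j hij
    have h : (j : ℕ) < i := hij
    have hi := i.isLt
    rw [submatrix_apply, pencil_apply]
    have : ¬ (k - ((i : ℕ) + 1) + j + 1 = k ∨ k - ((i : ℕ) + 1) + j = k) := by omega
    have : ¬ ((j : ℕ) + (k - ((i : ℕ) + 1)) + 1 = k ∨ j + (k - ((i : ℕ) + 1)) = k) := by omega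
    simp [gammaBlock, Fin.val_rev, *]

end Blocks

/-! ### Matrices with simple spectrum -/

section SimpleSpectrum

variable {τ : ℂ →+* ℂ} {m k R : Type*} [Fintype m] [DecidableEq m] [Fintype k] [DecidableEq k]
  [Fintype R]

/-- `A` is invertible and `s` consists of as many zeros of `det (A - z A^τ)` as `A` has rows. -/
def HasSimpleSpectrum (τ : ℂ →+* ℂ) (A : Matrix m m ℂ) (s : Finset ℂ) : Prop :=
  A.det ≠ 0 ∧ s.card = Fintype.card m ∧ ∀ z ∈ s, (pencil τ A z).det = 0

theorem TwistCongruent.hasSimpleSpectrum_iff (hτ : ∀ x, τ (τ x) = x) {A : Matrix m m ℂ}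
    {B : Matrix k k ℂ} (h : TwistCongruent τ A B) {s : Finset ℂ} :
    HasSimpleSpectrum τ A s ↔ HasSimpleSpectrum τ B s := by
  have h0 := h.det_pencil_eq_zero_iff hτ 0
  rw [pencil_zero, pencil_zero] at h0
  simp only [HasSimpleSpectrum, ne_eq, h0, h.det_pencil_eq_zero_iff hτ,
    Fintype.card_congr h.choose]

theorem HasSimpleSpectrum.card_le {A : Matrix m m ℂ} {s : Finset ℂ}
    (h : HasSimpleSpectrum τ A s) (r : R → ℂ)
    (hr : ∀ z, (pencil τ A z).det = 0 → ∃ i, r i = z) :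
    Fintype.card m ≤ Fintype.card R := by
  rw [← h.2.1]
  calc s.card ≤ (Finset.univ.image r).card :=
        Finset.card_le_card fun z hz => by simpa using hr z (h.2.2 z hz)
    _ ≤ Fintype.card R := Finset.card_image_le

/-- Equality case of the count in `HasSimpleSpectrum.card_le`: a list of at most `n` numbers that
covers `n` distinct zeros has no repetition. -/
theorem HasSimpleSpectrum.injective {A : Matrix m m ℂ} {s : Finset ℂ}
    (h : HasSimpleSpectrum τ A s) (r : R → ℂ)
    (hr : ∀ z, (pencil τ A z).det = 0 → ∃ i, r i = z)
    (hc : Fintype.card R ≤ Fintype.card m) : Function.Injective r := by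
  have h1 : s.card ≤ (Finset.univ.image r).card :=
    Finset.card_le_card fun z hz => by simpa using hr z (h.2.2 z hz)
  rw [h.2.1] at h1
  have h2 : (Finset.univ.image r).card = (Finset.univ : Finset R).card :=
    le_antisymm Finset.card_image_le (hc.trans h1)
  exact fun x y hxy => Finset.card_image_iff.1 h2 (by simp) (by simp) hxy

theorem hasSimpleSpectrum_image {A : Matrix m m ℂ} (hA : A.det ≠ 0) {r : R → ℂ}
    (hr : ∀ i, (pencil τ A (r i)).det = 0) (hinj : Function.Injective r)
    (hc : Fintype.card R = Fintype.card m) :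
    HasSimpleSpectrum τ A (Finset.univ.image r) := by
  refine ⟨hA, ?_, ?_⟩
  · rw [Finset.card_image_of_injective _ hinj, Finset.card_univ, hc]
  · intro z hz
    obtain ⟨i, -, rfl⟩ := Finset.mem_image.1 hz
    exact hr i

end SimpleSpectrum

theorem sum_fin_eq_one {n : ℕ} {l : Fin n → ℕ} (hl : ∀ j, 0 < l j) (h : ∑ j, l j ≤ n) (j : Fin n) :
    l j = 1 := by
  have h1 : ∑ j : Fin n, 1 ≤ ∑ j, l j := Finset.sum_le_sum fun j _ => hl j
  have h2 : ∑ j : Fin n, 1 = ∑ j, l j := le_antisymm h1 (by simpa using h)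
  exact ((Finset.sum_eq_sum_iff_of_le fun j _ => hl j).1 h2 j (Finset.mem_univ _)).symm

theorem le_sum_fin {n : ℕ} {l : Fin n → ℕ} (hl : ∀ j, 0 < l j) : n ≤ ∑ j, l j := by
  calc n = ∑ _j : Fin n, 1 := by simp
    _ ≤ ∑ j, l j := Finset.sum_le_sum fun j _ => hl j

theorem mul_eq_one_iff_inv_eq_left {z w : ℂ} (hw : w ≠ 0) : z * w = 1 ↔ w⁻¹ = z := by
  constructor
  · exact fun h => (eq_inv_of_mul_eq_one_left h).symm
  · rintro rfl
    exact inv_mul_cancel₀ hw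

/-! ### Spectra of canonical forms for `*`congruence -/

theorem star_root_iff {α : ℂ} (hα : ‖α‖ = 1) (z : ℂ) (p : ℕ) :
    α = z * starRingEnd ℂ α * (-1) ^ p ↔ z = α ^ 2 * (-1) ^ p := by
  have h : α * starRingEnd ℂ α = 1 := by
    rw [Complex.mul_conj, Complex.normSq_eq_norm_sq, hα]; simp
  have hp : ((-1 : ℂ) ^ p) * (-1) ^ p = 1 := by rw [← mul_pow]; simp
  constructor
  · intro e
    calc z = z * (α * starRingEnd ℂ α) * ((-1 : ℂ) ^ p * (-1) ^ p) := by rw [h, hp]; ring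
      _ = α * (z * starRingEnd ℂ α * (-1) ^ p) * (-1) ^ p := by ring
      _ = α ^ 2 * (-1) ^ p := by rw [← e]; ring
  · rintro rfl
    calc α = α * (α * starRingEnd ℂ α) * ((-1 : ℂ) ^ p * (-1) ^ p) := by rw [h, hp]; ring
      _ = _ := by ring

theorem StarShape.card_idx (S : StarShape) :
    Fintype.card S.Idx = ∑ j, S.k j + ∑ j, S.l j + (∑ j, S.m j + ∑ j, S.m j) := by
  simp [Finset.sum_add_distrib]

theorem StarShape.det_pencil_form_eq_zero_iff {τ : ℂ →+* ℂ} (S : StarShape) (α : Fin S.n₂ → ℂ)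
    (μ : Fin S.n₃ → ℂ) (z : ℂ) :
    (pencil τ (S.form α μ) z).det = 0 ↔
      ((∃ j, (pencil τ (jordanBlock (S.k j) 0) z).det = 0) ∨
        ∃ j, α j = z * τ (α j) * (-1) ^ (S.l j + 1)) ∨ ∃ j, z = μ j ∨ z * τ (μ j) = 1 := by
  rw [StarShape.form, det_pencil_dsum, det_pencil_dsum, mul_eq_zero, mul_eq_zero,
    det_pencil_blockDiagonal'_eq_zero_iff, det_pencil_blockDiagonal'_eq_zero_iff,
    det_pencil_blockDiagonal'_eq_zero_iff]
  simp only [det_pencil_smul_gammaBlock_eq_zero_iff (S.l_pos _),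
    det_pencil_hBlock_eq_zero_iff (S.m_pos _)]

/-- The zeros of `det (A - z A^*)`, for an invertible canonical form `A` for `*`congruence. -/
def StarShape.root (S : StarShape) (α : Fin S.n₂ → ℂ) (μ : Fin S.n₃ → ℂ) :
    Fin S.n₂ ⊕ (Fin S.n₃ ⊕ Fin S.n₃) → ℂ :=
  Sum.elim (fun j => α j ^ 2 * (-1) ^ (S.l j + 1))
    (Sum.elim μ fun j => (starRingEnd ℂ (μ j))⁻¹)

theorem StarShape.det_pencil_form_eq_zero_iff_root (S : StarShape) (hS : S.n₁ = 0)
    {α : Fin S.n₂ → ℂ} {μ : Fin S.n₃ → ℂ} (hα : ∀ j, ‖α j‖ = 1) (hμ : ∀ j, 1 < ‖μ j‖) (z : ℂ) :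
    (pencil (starRingEnd ℂ) (S.form α μ) z).det = 0 ↔ ∃ i, S.root α μ i = z := by
  have : IsEmpty (Fin S.n₁) := by rw [hS]; infer_instance
  have hμ' : ∀ j, z * starRingEnd ℂ (μ j) = 1 ↔ (starRingEnd ℂ (μ j))⁻¹ = z := fun j => by
    refine mul_eq_one_iff_inv_eq_left ?_
    rw [Ne, map_eq_zero, ← norm_eq_zero]
    linarith [hμ j]
  rw [S.det_pencil_form_eq_zero_iff]
  simp [StarShape.root, star_root_iff (hα _), hμ', exists_or, eq_comm]

/-- Invertibility excludes Jordan blocks. There are then `∑ l + 2 ∑ m` rows and at most `n₂ + 2 n₃`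
zeros, so all sizes are `1` and the listed zeros are distinct. -/
theorem StarShape.eq_one_of_hasSimpleSpectrum (S : StarShape) {α : Fin S.n₂ → ℂ}
    {μ : Fin S.n₃ → ℂ} (hα : ∀ j, ‖α j‖ = 1) (hμ : ∀ j, 1 < ‖μ j‖) {s : Finset ℂ}
    (h : HasSimpleSpectrum (starRingEnd ℂ) (S.form α μ) s) :
    S.n₁ = 0 ∧ (∀ j, S.l j = 1) ∧ (∀ j, S.m j = 1) ∧ (∀ i j, i ≠ j → α i ^ 2 ≠ α j ^ 2) ∧
      ∀ i j, i ≠ j → μ i ≠ μ j := by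
  have h1 : S.n₁ = 0 := by
    by_contra hne
    have hd := h.1
    rw [← pencil_zero (τ := starRingEnd ℂ) (S.form α μ), Ne, S.det_pencil_form_eq_zero_iff] at hd
    exact hd (.inl (.inl ⟨⟨0, Nat.pos_of_ne_zero hne⟩,
      det_pencil_jordanBlock_zero_zero (S.k_pos _)⟩))
  have hroot := fun z => (S.det_pencil_form_eq_zero_iff_root h1 hα hμ z).1
  have hcard := h.card_le _ hroot
  rw [S.card_idx] at hcard
  simp only [Fintype.card_sum, Fintype.card_fin] at hcard
  have hl := le_sum_fin S.l_pos
  have hm := le_sum_fin S.m_pos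
  have hl1 := sum_fin_eq_one S.l_pos (by omega)
  have hm1 := sum_fin_eq_one S.m_pos (by omega)
  have hinj := h.injective _ hroot (by
    rw [S.card_idx]
    simp only [Fintype.card_sum, Fintype.card_fin]
    omega)
  refine ⟨h1, hl1, hm1, fun i j hij e => hij ?_, fun i j hij e => hij ?_⟩
  · simpa using @hinj (.inl i) (.inl j) (by simp [StarShape.root, hl1, e])
  · simpa using @hinj (.inr (.inl i)) (.inr (.inl j)) (by simp [StarShape.root, e])

/-- The zeros coming from `α_j`, from `μ_j` and from their reflections have modulus equal to, above
and below `1`, so coincidences can occur only within one kind. -/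
theorem StarShape.exists_hasSimpleSpectrum (S : StarShape) {α : Fin S.n₂ → ℂ}
    {μ : Fin S.n₃ → ℂ} (hα : ∀ j, ‖α j‖ = 1) (hμ : ∀ j, 1 < ‖μ j‖) (hk : S.n₁ = 0)
    (hl : ∀ j, S.l j = 1) (hm : ∀ j, S.m j = 1) (hαi : ∀ i j, i ≠ j → α i ^ 2 ≠ α j ^ 2)
    (hμi : ∀ i j, i ≠ j → μ i ≠ μ j) :
    ∃ s, HasSimpleSpectrum (starRingEnd ℂ) (S.form α μ) s ∧
      (s.filter fun z => ‖z‖ ≠ 1).card = 2 * S.n₃ := by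
  have hroot := S.det_pencil_form_eq_zero_iff_root hk hα hμ
  have n1 : ∀ j, ‖S.root α μ (.inl j)‖ = 1 := fun j => by simp [StarShape.root, hα]
  have n2 : ∀ j, 1 < ‖S.root α μ (.inr (.inl j))‖ := fun j => by simp [StarShape.root, hμ]
  have n3 : ∀ j, ‖S.root α μ (.inr (.inr j))‖ < 1 := fun j => by
    simpa [StarShape.root] using inv_lt_one_of_one_lt₀ (hμ j)
  have hinj : Function.Injective (S.root α μ) := by
    rintro (i | i | i) (j | j | j) e <;> have e' := congrArg norm e
    · by_contra hne
      exact hαi i j (by simpa using hne) (by simpa [StarShape.root, hl] using e)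
    · linarith [n1 i, n2 j]
    · linarith [n1 i, n3 j]
    · linarith [n1 j, n2 i]
    · by_contra hne
      exact hμi i j (by simpa using hne) (by simpa [StarShape.root] using e)
    · linarith [n3 j, n2 i]
    · linarith [n1 j, n3 i]
    · linarith [n2 j, n3 i]
    · by_contra hne
      exact hμi i j (by simpa using hne)
        ((starRingEnd ℂ).injective (by simpa [StarShape.root] using e))
  have hempty : IsEmpty (Fin S.n₁) := by rw [hk]; infer_instance
  refine ⟨_, hasSimpleSpectrum_image (r := S.root α μ) ?_ (fun i => (hroot _).2 ⟨i, rfl⟩) hinj ?_,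
    ?_⟩
  · rw [← pencil_zero (τ := starRingEnd ℂ) (S.form α μ), Ne, hroot]
    rintro ⟨i, hi⟩
    rcases i with i | i | i
    · have := n1 i
      simp [hi] at this
    · have := n2 i
      rw [hi, norm_zero] at this
      linarith
    · have := hμ i
      simp only [StarShape.root, Sum.elim_inr, inv_eq_zero, map_eq_zero] at hi
      rw [hi, norm_zero] at this
      linarith
  · rw [S.card_idx]
    simp [hl, hm]
  · have : (Finset.univ.image (S.root α μ)).filter (fun z => ‖z‖ ≠ 1) =
        Finset.univ.image fun i => S.root α μ (.inr i) := by
      ext z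
      simp only [Finset.mem_filter, Finset.mem_image, Finset.mem_univ, true_and]
      constructor
      · rintro ⟨⟨i | i, rfl⟩, hz⟩
        · exact absurd (n1 i) hz
        · exact ⟨i, rfl⟩
      · rintro ⟨i, rfl⟩
        refine ⟨⟨_, rfl⟩, ?_⟩
        rcases i with i | i
        · exact (n2 i).ne'
        · exact (n3 i).ne
    rw [this, Finset.card_image_of_injective _ fun i j e => by simpa using hinj e]
    simp [two_mul]

/-! ### Spectra of canonical forms for congruence -/

theorem congruenceParam_iff {μ : ℂ} : CongruenceParam μ ↔ 1 < ‖μ‖ ∨ ‖μ‖ = 1 ∧ 0 < μ.im := by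
  refine or_congr Iff.rfl ⟨?_, ?_⟩
  · rintro ⟨θ, h0, hπ, rfl⟩
    refine ⟨Complex.norm_exp_ofReal_mul_I θ, ?_⟩
    rw [Complex.exp_ofReal_mul_I_im]
    exact Real.sin_pos_of_pos_of_lt_pi h0 hπ
  · rintro ⟨h1, him⟩
    refine ⟨μ.arg, ?_, ?_, ?_⟩
    · refine lt_of_le_of_ne (Complex.arg_nonneg_iff.2 him.le) fun h => ?_
      exact him.ne' (Complex.arg_eq_zero_iff.1 h.symm).2
    · exact Complex.arg_lt_pi_iff.2 (.inr him.ne')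
    · simpa [h1] using (Complex.norm_mul_exp_arg_mul_I μ).symm

theorem CongruenceParam.one_le_norm {μ : ℂ} (h : CongruenceParam μ) : 1 ≤ ‖μ‖ := by
  rcases congruenceParam_iff.1 h with h | h
  · exact h.le
  · exact h.1.ge

theorem CongruenceParam.ne_zero {μ : ℂ} (h : CongruenceParam μ) : μ ≠ 0 := by
  rintro rfl
  simpa using h.one_le_norm.trans_lt' zero_lt_one

/-- Admissible numbers contain at most one of `z` and `z⁻¹`, and neither of `±1`: a product equal to
`1` puts both factors on the circle and makes them conjugate, but both have positive imaginary part.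
-/
theorem CongruenceParam.mul_ne_one {μ ν : ℂ} (hμ : CongruenceParam μ) (hν : CongruenceParam ν) :
    μ * ν ≠ 1 := by
  intro h
  have hn : ‖μ‖ * ‖ν‖ = 1 := by rw [← norm_mul, h, norm_one]
  have h1 := hμ.one_le_norm
  have h2 := hν.one_le_norm
  have h3 : ‖μ‖ = 1 := by nlinarith
  have h4 : ‖ν‖ = 1 := by nlinarith
  have h5 := (congruenceParam_iff.1 hμ).resolve_left (by linarith)
  have h6 := (congruenceParam_iff.1 hν).resolve_left (by linarith)
  have h7 : ν = starRingEnd ℂ μ := by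
    rw [← Complex.inv_eq_conj h3]
    exact eq_inv_of_mul_eq_one_right h
  have := h6.2
  rw [h7, Complex.conj_im] at this
  linarith [h5.2]

theorem CongruenceParam.ne_one {μ : ℂ} (h : CongruenceParam μ) : μ ≠ 1 := by
  rintro rfl
  exact h.mul_ne_one h (one_mul 1)

theorem CongruenceShape.card_idx (S : CongruenceShape) :
    Fintype.card S.Idx = ∑ j, S.k j + ∑ j, S.l j +
      ((∑ j, S.m j + ∑ j, S.m j) + (∑ j, S.p j + ∑ j, S.p j)) := by
  simp [Finset.sum_add_distrib]

theorem CongruenceShape.det_pencil_form_eq_zero_iff {τ : ℂ →+* ℂ} (S : CongruenceShape)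
    (μ : Fin S.n₃ → ℂ) (z : ℂ) :
    (pencil τ (S.form μ) z).det = 0 ↔
      ((∃ j, (pencil τ (jordanBlock (S.k j) 0) z).det = 0) ∨ ∃ j, 1 = z * (-1) ^ (S.l j + 1)) ∨
        (∃ j, z = μ j ∨ z * τ (μ j) = 1) ∨ ∃ j, z = (-1) ^ S.p j := by
  have hΓ : ∀ j, (pencil τ (gammaBlock (S.l j)) z).det = 0 ↔ 1 = z * (-1) ^ (S.l j + 1) :=
    fun j => by
      simpa using det_pencil_smul_gammaBlock_eq_zero_iff (τ := τ) (S.l_pos j) 1 z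
  -- `±1` is its own inverse, so these blocks have one zero for `2p` rows, too few for a simple
  -- spectrum.
  have hp : ∀ j, (z = (-1) ^ S.p j ∨ z * τ ((-1) ^ S.p j) = 1) ↔ z = (-1) ^ S.p j := by
    intro j
    rcases neg_one_pow_eq_or ℂ (S.p j) with h | h <;> simp [h, neg_eq_iff_eq_neg]
  rw [CongruenceShape.form, det_pencil_dsum, det_pencil_dsum, det_pencil_dsum, mul_eq_zero,
    mul_eq_zero, mul_eq_zero, det_pencil_blockDiagonal'_eq_zero_iff,
    det_pencil_blockDiagonal'_eq_zero_iff, det_pencil_blockDiagonal'_eq_zero_iff,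
    det_pencil_blockDiagonal'_eq_zero_iff]
  simp only [hΓ, det_pencil_hBlock_eq_zero_iff (S.m_pos _),
    det_pencil_hBlock_eq_zero_iff (S.p_pos _), hp]

/-- The zeros of `det (A - z Aᵀ)`, for an invertible canonical form `A` for congruence. -/
def CongruenceShape.root (S : CongruenceShape) (μ : Fin S.n₃ → ℂ) :
    Fin S.n₂ ⊕ ((Fin S.n₃ ⊕ Fin S.n₃) ⊕ Fin S.n₄) → ℂ :=
  Sum.elim (fun j => (-1) ^ (S.l j + 1))
    (Sum.elim (Sum.elim μ fun j => (μ j)⁻¹) fun j => (-1) ^ S.p j)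

theorem CongruenceShape.det_pencil_form_eq_zero_iff_root (S : CongruenceShape) (hS : S.n₁ = 0)
    {μ : Fin S.n₃ → ℂ} (hμ : ∀ j, CongruenceParam (μ j)) (z : ℂ) :
    (pencil (RingHom.id ℂ) (S.form μ) z).det = 0 ↔ ∃ i, S.root μ i = z := by
  have : IsEmpty (Fin S.n₁) := by rw [hS]; infer_instance
  have hμ' : ∀ j, z * μ j = 1 ↔ (μ j)⁻¹ = z := fun j =>
    mul_eq_one_iff_inv_eq_left (hμ j).ne_zero
  have hΓ : ∀ j, 1 = z * (-1) ^ (S.l j + 1) ↔ (-1) ^ (S.l j + 1) = z := by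
    intro j
    rcases neg_one_pow_eq_or ℂ (S.l j + 1) with h | h
    · simp [h]
    · rw [h, mul_neg_one, eq_neg_iff_add_eq_zero, neg_eq_iff_add_eq_zero]
  rw [S.det_pencil_form_eq_zero_iff]
  simp [CongruenceShape.root, -RingHom.id_apply, RingHom.id_apply (μ _), hΓ, hμ', exists_or,
    @eq_comm _ z]

theorem CongruenceShape.eq_one_of_hasSimpleSpectrum (S : CongruenceShape)
    {μ : Fin S.n₃ → ℂ} (hμ : ∀ j, CongruenceParam (μ j)) {s : Finset ℂ}
    (h : HasSimpleSpectrum (RingHom.id ℂ) (S.form μ) s) :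
    S.n₁ = 0 ∧ S.n₂ ≤ 1 ∧ S.n₄ = 0 ∧ (∀ j, S.l j = 1) ∧ (∀ j, S.m j = 1) ∧
      ∀ i j, i ≠ j → μ i ≠ μ j := by
  have h1 : S.n₁ = 0 := by
    by_contra hne
    have hd := h.1
    rw [← pencil_zero (τ := RingHom.id ℂ) (S.form μ), Ne, S.det_pencil_form_eq_zero_iff] at hd
    exact hd (.inl (.inl ⟨⟨0, Nat.pos_of_ne_zero hne⟩,
      det_pencil_jordanBlock_zero_zero (S.k_pos _)⟩))
  have hroot := fun z => (S.det_pencil_form_eq_zero_iff_root h1 hμ z).1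
  have hcard := h.card_le _ hroot
  rw [S.card_idx] at hcard
  simp only [Fintype.card_sum, Fintype.card_fin] at hcard
  have hl := le_sum_fin S.l_pos
  have hm := le_sum_fin S.m_pos
  have hp := le_sum_fin S.p_pos
  have hl1 := sum_fin_eq_one S.l_pos (by omega)
  have hm1 := sum_fin_eq_one S.m_pos (by omega)
  have hinj := h.injective _ hroot (by
    rw [S.card_idx]
    simp only [Fintype.card_sum, Fintype.card_fin]
    omega)
  refine ⟨h1, ?_, by omega, hl1, hm1, fun i j hij e => hij ?_⟩
  -- Each block `Γ_1` has the zero `1`, so two of them would repeat it.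
  · by_contra! hlt
    have := @hinj (.inl ⟨0, by omega⟩) (.inl ⟨1, hlt⟩) (by simp [CongruenceShape.root, hl1])
    exact absurd (Fin.mk.inj (Sum.inl.inj this)) zero_ne_one
  · simpa using @hinj (.inr (.inl (.inl i))) (.inr (.inl (.inl j)))
      (by simp [CongruenceShape.root, e])

theorem CongruenceShape.exists_hasSimpleSpectrum (S : CongruenceShape)
    {μ : Fin S.n₃ → ℂ} (hμ : ∀ j, CongruenceParam (μ j)) (hk : S.n₁ = 0) (h2 : S.n₂ ≤ 1)
    (hp : S.n₄ = 0) (hl : ∀ j, S.l j = 1) (hm : ∀ j, S.m j = 1)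
    (hμi : ∀ i j, i ≠ j → μ i ≠ μ j) :
    ∃ s, HasSimpleSpectrum (RingHom.id ℂ) (S.form μ) s := by
  have hroot := S.det_pencil_form_eq_zero_iff_root hk hμ
  have hempty : IsEmpty (Fin S.n₁) := by rw [hk]; infer_instance
  have hempty' : IsEmpty (Fin S.n₄) := by rw [hp]; infer_instance
  have hsub : Subsingleton (Fin S.n₂) := Fin.subsingleton_iff_le_one.2 h2
  have e1 : ∀ i, S.root μ (.inl i) = 1 := fun i => by simp [CongruenceShape.root, hl]
  have e2 : ∀ i, S.root μ (.inr (.inl (.inl i))) = μ i := fun i => rfl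
  have e3 : ∀ i, S.root μ (.inr (.inl (.inr i))) = (μ i)⁻¹ := fun i => rfl
  have hmul : ∀ i j, μ i ≠ (μ j)⁻¹ := fun i j e =>
    (hμ i).mul_ne_one (hμ j) ((mul_eq_one_iff_inv_eq_left (hμ j).ne_zero).2 e.symm)
  have hne : ∀ i, (μ i)⁻¹ ≠ 1 := fun i e => (hμ i).ne_one (inv_eq_one.1 e)
  have hinj : Function.Injective (S.root μ) := by
    rintro (i | (i | i) | i) (j | (j | j) | j) e <;> (try exact isEmptyElim i) <;>
      (try exact isEmptyElim j) <;> simp only [e1, e2, e3] at e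
    · rw [Subsingleton.elim i j]
    · exact absurd e.symm (hμ j).ne_one
    · exact absurd e.symm (hne j)
    · exact absurd e (hμ i).ne_one
    · by_contra hij
      exact hμi i j (by simpa using hij) e
    · exact absurd e (hmul i j)
    · exact absurd e (hne i)
    · exact absurd e.symm (hmul j i)
    · by_contra hij
      exact hμi i j (by simpa using hij) (inv_injective e)
  refine ⟨_, hasSimpleSpectrum_image (r := S.root μ) ?_ (fun i => (hroot _).2 ⟨i, rfl⟩) hinj ?_⟩
  · rw [← pencil_zero (τ := RingHom.id ℂ) (S.form μ), Ne, hroot]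
    rintro ⟨i | (i | i) | i, hi⟩
    · simp [e1] at hi
    · exact (hμ i).ne_zero hi
    · exact (hμ i).ne_zero (inv_eq_zero.1 hi)
    · exact isEmptyElim i
  · rw [S.card_idx]
    simp [hl, hm, hp]

/-! ### Reduction of matrices with simple spectrum -/

/-- The direct sum `⨁ H_2(μ_i) ⊕ ⨁ c_j`. -/
def simpleForm {ι κ : Type*} [DecidableEq ι] [DecidableEq κ] (μ : ι → ℂ) (c : κ → ℂ) :
    Matrix ((Σ _ : ι, Fin 1 ⊕ Fin 1) ⊕ κ) ((Σ _ : ι, Fin 1 ⊕ Fin 1) ⊕ κ) ℂ :=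
  dsum (Matrix.blockDiagonal' fun i => hBlock 1 (μ i)) (Matrix.diagonal c)

theorem hBlock_one_inl_inl (μ : ℂ) (x y : Fin 1) : hBlock 1 μ (.inl x) (.inl y) = 0 := rfl

theorem hBlock_one_inr_inr (μ : ℂ) (x y : Fin 1) : hBlock 1 μ (.inr x) (.inr y) = 0 := rfl

theorem hBlock_one_inl_inr (μ : ℂ) (x y : Fin 1) : hBlock 1 μ (.inl x) (.inr y) = 1 := by
  rw [Subsingleton.elim x 0, Subsingleton.elim y 0]
  rfl

theorem hBlock_one_inr_inl (μ : ℂ) (x y : Fin 1) : hBlock 1 μ (.inr x) (.inl y) = μ := by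
  rw [Subsingleton.elim x 0, Subsingleton.elim y 0]
  rfl

theorem twistCongruent_of_twistTranspose_mul_mul {τ : ℂ →+* ℂ} (hτ : ∀ x, τ (τ x) = x)
    {m k : Type*} [Fintype m] [DecidableEq m] {A W : Matrix m m ℂ} {B : Matrix k k ℂ} (e : m ≃ k)
    (hW : W.det ≠ 0) (h : twistTranspose τ W * A * W = B.submatrix e e) : TwistCongruent τ A B := by
  have hu : IsUnit W.det := isUnit_iff_ne_zero.2 hW
  have hP : twistTranspose τ W⁻¹ * twistTranspose τ W = 1 := by
    rw [← twistTranspose_mul, mul_nonsing_inv _ hu, twistTranspose_one]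
  refine ⟨e, twistTranspose τ W⁻¹, IsUnit.of_mul_eq_one _ hP, ?_⟩
  rw [twistTranspose_twistTranspose hτ, ← h]
  calc A = (twistTranspose τ W⁻¹ * twistTranspose τ W) * A * (W * W⁻¹) := by
        rw [hP, mul_nonsing_inv _ hu, Matrix.one_mul, Matrix.mul_one]
    _ = _ := by simp only [Matrix.mul_assoc]

/-- A matrix with simple spectrum has a basis of eigenvectors of its pencil. -/
theorem HasSimpleSpectrum.exists_eigenvectors {τ : ℂ →+* ℂ} {n : ℕ}
    {B : Matrix (Fin n) (Fin n) ℂ} {s : Finset ℂ} (h : HasSimpleSpectrum τ B s) :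
    ∃ (lam : Fin n → ℂ) (V : Matrix (Fin n) (Fin n) ℂ), Function.Injective lam ∧ V.det ≠ 0 ∧
      B * V = twistTranspose τ B * V * diagonal lam := by
  have hcard : s.card = n := by simpa using h.2.1
  let lam : Fin n → ℂ := fun i => ((s.equivFinOfCardEq hcard).symm i : ℂ)
  have hinj : Function.Injective lam := Subtype.val_injective.comp (Equiv.injective _)
  have hv : ∀ i, ∃ v : Fin n → ℂ, v ≠ 0 ∧ pencil τ B (lam i) *ᵥ v = 0 := fun i =>
    exists_mulVec_eq_zero_iff.2 (h.2.2 _ ((s.equivFinOfCardEq hcard).symm i).2)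
  choose v hv0 hv using hv
  have hv' : ∀ i, B *ᵥ v i = lam i • (twistTranspose τ B *ᵥ v i) := fun i => by
    have := hv i
    rwa [pencil, sub_mulVec, smul_mulVec, sub_eq_zero] at this
  have hu : IsUnit (twistTranspose τ B).det := by
    rw [det_twistTranspose, isUnit_iff_ne_zero, Ne, map_eq_zero]
    exact h.1
  -- Kernel vectors of the pencil are eigenvectors of the cosquare `(B^τ)⁻¹ B`, here for distinct
  -- eigenvalues.
  have hli : LinearIndependent ℂ v := by
    refine Module.End.eigenvectors_linearIndependent'
      (toLin' ((twistTranspose τ B)⁻¹ * B)) lam hinj v fun i => ?_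
    rw [Module.End.hasEigenvector_iff, Module.End.mem_eigenspace_iff]
    refine ⟨?_, hv0 i⟩
    rw [toLin'_apply, ← mulVec_mulVec, hv', mulVec_smul, mulVec_mulVec, nonsing_inv_mul _ hu,
      one_mulVec]
  refine ⟨lam, Matrix.of fun x i => v i x, hinj, ?_, ?_⟩
  · have : IsUnit (Matrix.of fun x i => v i x) := by
      rw [← linearIndependent_cols_iff_isUnit]
      exact hli
    exact ((isUnit_iff_isUnit_det _).1 this).ne_zero
  · ext x i
    rw [mul_diagonal]
    have := congrFun (hv' i) x
    simpa [mulVec, dotProduct, Matrix.mul_apply, mul_comm] using this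

/-- Applying the relation twice returns `M i j` multiplied by `lam j * τ (lam i)`. -/
theorem mul_eq_one_of_eq_twistTranspose_mul_diagonal {τ : ℂ →+* ℂ} (hτ : ∀ x, τ (τ x) = x)
    {n : ℕ} {M : Matrix (Fin n) (Fin n) ℂ} {lam : Fin n → ℂ}
    (hM : M = twistTranspose τ M * diagonal lam) (i j : Fin n) (h : M i j ≠ 0) :
    lam j * τ (lam i) = 1 := by
  have h1 : ∀ i j, M i j = τ (M j i) * lam j := fun i j => by
    conv_lhs => rw [hM, mul_diagonal, twistTranspose_apply]
  have h2 : M i j = M i j * (lam j * τ (lam i)) := by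
    conv_lhs => rw [h1, h1 j i, map_mul, hτ]
    ring
  exact (mul_right_eq_self₀.1 h2.symm).resolve_right h

/-- `adm` selects one point of each 2-cycle of `z ↦ (τ z)⁻¹`, and `N` is the normalisation of the `1
× 1` blocks attainable by `c ↦ τ(d) c d`. The condition on the `c_i` expresses that the eigenvalues
`c_i / τ(c_i)` are distinct. -/
theorem HasSimpleSpectrum.exists_twistCongruent {τ : ℂ →+* ℂ} (hτ : ∀ x, τ (τ x) = x)
    {adm N : ℂ → Prop} (hadm : ∀ z, z ≠ 0 → z * τ z ≠ 1 → adm z ∨ adm (τ z)⁻¹)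
    (hadm' : ∀ z w, adm z → adm w → w * τ z ≠ 1)
    (hN : ∀ c, c ≠ 0 → ∃ d, d ≠ 0 ∧ N (τ d * c * d)) {n : ℕ}
    {B : Matrix (Fin n) (Fin n) ℂ} {s : Finset ℂ} (h : HasSimpleSpectrum τ B s) :
    ∃ (ℓ t : ℕ) (μ : Fin ℓ → ℂ) (c : Fin t → ℂ), (∀ i, adm (μ i)) ∧
      (∀ i j, i ≠ j → μ i ≠ μ j) ∧ (∀ j, N (c j)) ∧
      (∀ i j, i ≠ j → c i * τ (c j) ≠ c j * τ (c i)) ∧ TwistCongruent τ B (simpleForm μ c) := by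
  classical
  obtain ⟨lam, V, hinj, hV, hBV⟩ := h.exists_eigenvectors
  set M := twistTranspose τ V * B * V with hMdef
  have hM : M = twistTranspose τ M * diagonal lam := by
    rw [hMdef, twistTranspose_mul, twistTranspose_mul, twistTranspose_twistTranspose hτ,
      Matrix.mul_assoc, hBV]
    simp only [Matrix.mul_assoc]
  have hMij : ∀ i j, M i j = τ (M j i) * lam j := fun i j => by
    conv_lhs => rw [hM, mul_diagonal, twistTranspose_apply]
  have hMdet : M.det ≠ 0 := by
    rw [hMdef, det_mul, det_mul, det_twistTranspose]
    exact mul_ne_zero (mul_ne_zero (by rwa [Ne, map_eq_zero]) h.1) hV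
  have hlam := mul_eq_one_of_eq_twistTranspose_mul_diagonal hτ hM
  have hex : ∀ i, ∃ j, M i j ≠ 0 := fun i => by
    by_contra! hc
    exact hMdet (det_eq_zero_of_row_eq_zero i hc)
  -- `σ i` is the column of a nonzero entry in row `i`; distinctness of the eigenvalues makes it the
  -- only one and `σ` an involution.
  choose σ hσ using hex
  have hlσ : ∀ i, lam (σ i) * τ (lam i) = 1 := fun i => hlam i _ (hσ i)
  have hl0 : ∀ i, lam i ≠ 0 := fun i hi => by simpa [hi] using hlσ i
  have hτ0 : ∀ z, z ≠ 0 → τ z ≠ 0 := fun z hz => by rwa [Ne, map_eq_zero]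
  have huniq : ∀ i j, lam j * τ (lam i) = 1 → j = σ i := fun i j hij =>
    hinj (mul_right_cancel₀ (hτ0 _ (hl0 i)) (hij.trans (hlσ i).symm))
  have hzero : ∀ i j, j ≠ σ i → M i j = 0 := fun i j hij => by
    by_contra hc
    exact hij (huniq i j (hlam i j hc))
  have hσσ : ∀ i, σ (σ i) = i := fun i => by
    refine (huniq _ _ ?_).symm
    have := congrArg τ (hlσ i)
    rw [map_mul, hτ, map_one] at this
    rw [mul_comm, this]
  let eI := (Fintype.equivFin {i // adm (lam i)}).symm
  let eK := (Fintype.equivFin {i // lam i * τ (lam i) = 1}).symm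
  have hfix : ∀ b, σ (eK b) = eK b := fun b => (huniq _ _ (eK b).2).symm
  let g : ((Σ _ : Fin _, Fin 1 ⊕ Fin 1) ⊕ Fin _) → Fin n :=
    Sum.elim (fun p => Sum.elim (fun _ => (eI p.1 : Fin n)) (fun _ => σ (eI p.1)) p.2)
      fun b => eK b
  have hIσ : ∀ a a', (eI a : Fin n) ≠ σ (eI a') := fun a a' e =>
    hadm' _ _ (eI a').2 (eI a).2 (by rw [e]; exact hlσ _)
  have hIK : ∀ a b, (eI a : Fin n) ≠ eK b := fun a b e =>
    hadm' _ _ (eI a).2 (eI a).2 (by rw [e]; exact (eK b).2)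
  have hσK : ∀ a b, σ (eI a) ≠ eK b := fun a b e => by
    have := congrArg σ e
    rw [hσσ, hfix] at this
    exact hIK a b this
  have hginj : Function.Injective g := by
    rintro (⟨a, x | x⟩ | a) (⟨b, y | y⟩ | b) hab <;>
      simp only [g, Sum.elim_inl, Sum.elim_inr] at hab
    · rw [eI.injective (Subtype.ext hab), Subsingleton.elim x y]
    · exact absurd hab (hIσ _ _)
    · exact absurd hab (hIK _ _)
    · exact absurd hab.symm (hIσ _ _)
    · have := congrArg σ hab
      rw [hσσ, hσσ] at this
      rw [eI.injective (Subtype.ext this), Subsingleton.elim x y]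
    · exact absurd hab (hσK _ _)
    · exact absurd hab.symm (hIK _ _)
    · exact absurd hab.symm (hσK _ _)
    · rw [eK.injective (Subtype.ext hab)]
  have hgsurj : Function.Surjective g := by
    intro i
    by_cases h1 : lam i * τ (lam i) = 1
    · exact ⟨.inr (eK.symm ⟨i, h1⟩), by simp [g]⟩
    · rcases hadm _ (hl0 i) h1 with h2 | h2
      · exact ⟨.inl ⟨eI.symm ⟨i, h2⟩, .inl 0⟩, by simp [g]⟩
      · have : (τ (lam i))⁻¹ = lam (σ i) := (eq_inv_of_mul_eq_one_left (hlσ i)).symm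
        rw [this] at h2
        exact ⟨.inl ⟨eI.symm ⟨σ i, h2⟩, .inr 0⟩, by simp [g, hσσ]⟩
  let e := Equiv.ofBijective g ⟨hginj, hgsurj⟩
  have hMK : ∀ b, M (eK b) (eK b) ≠ 0 := fun b => by
    have := hσ (eK b)
    rwa [hfix] at this
  choose d hd hdN using fun b => hN _ (hMK b)
  -- Scaling the first vector of each pair turns the entry `(i, σ i)` into `1`; by `hMij` the entry
  -- `(σ i, i)` then becomes the eigenvalue.
  let sc : ((Σ _ : Fin _, Fin 1 ⊕ Fin 1) ⊕ Fin _) → ℂ :=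
    Sum.elim (fun p => Sum.elim (fun _ => (τ (M (eI p.1) (σ (eI p.1))))⁻¹) (fun _ => 1) p.2) d
  have hsc : ∀ x, sc x ≠ 0 := by
    rintro (⟨a, x | x⟩ | b)
    · exact inv_ne_zero (hτ0 _ (hσ _))
    · exact one_ne_zero
    · exact hd b
  let μ := fun a => lam (eI a)
  let c := fun b => τ (d b) * M (eK b) (eK b) * d b
  have hc : ∀ b, c b = lam (eK b) * τ (c b) := fun b => by
    simp only [c, map_mul, hτ]
    conv_lhs => rw [hMij]
    ring
  have hc0 : ∀ b, c b ≠ 0 := fun b => mul_ne_zero (mul_ne_zero (hτ0 _ (hd b)) (hMK b)) (hd b)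
  refine ⟨_, _, μ, c, fun a => (eI a).2, fun a b hab hμ => hab ?_, hdN, fun a b hab hcc => hab ?_,
    twistCongruent_of_twistTranspose_mul_mul hτ e.symm
      (W := V * diagonal fun i => sc (e.symm i)) ?_ ?_⟩
  · exact eI.injective (Subtype.ext (hinj hμ))
  · have h1 : lam (eK a) * (τ (c a) * τ (c b)) = lam (eK b) * (τ (c a) * τ (c b)) := by
      calc _ = (lam (eK a) * τ (c a)) * τ (c b) := by ring
        _ = (lam (eK b) * τ (c b)) * τ (c a) := by rw [← hc a, ← hc b, hcc]
        _ = _ := by ring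
    exact eK.injective (Subtype.ext (hinj (mul_right_cancel₀
      (mul_ne_zero (hτ0 _ (hc0 a)) (hτ0 _ (hc0 b))) h1)))
  · rw [det_mul, det_diagonal]
    exact mul_ne_zero hV (Finset.prod_ne_zero_iff.2 fun i _ => hsc _)
  · have hW : twistTranspose τ (V * diagonal fun i => sc (e.symm i)) * B *
        (V * diagonal fun i => sc (e.symm i)) =
        diagonal (fun i => τ (sc (e.symm i))) * M * diagonal fun i => sc (e.symm i) := by
      have : twistTranspose τ (diagonal fun i => sc (e.symm i)) =
          diagonal (fun i => τ (sc (e.symm i))) := by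
        simp [twistTranspose, diagonal_map]
      rw [twistTranspose_mul, this, hMdef]
      simp only [Matrix.mul_assoc]
    rw [hW]
    ext i j
    rw [mul_diagonal, diagonal_mul, submatrix_apply]
    obtain ⟨x, rfl⟩ := e.surjective i
    obtain ⟨y, rfl⟩ := e.surjective j
    rw [e.symm_apply_apply, e.symm_apply_apply]
    have e1 : ∀ a x, e (.inl ⟨a, .inl x⟩) = eI a := fun _ _ => rfl
    have e2 : ∀ a x, e (.inl ⟨a, .inr x⟩) = σ (eI a) := fun _ _ => rfl
    have e3 : ∀ b, e (.inr b) = eK b := fun _ => rfl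
    have hI : ∀ a b, b ≠ a → (eI b : Fin n) ≠ eI a := fun a b hab hc =>
      hab (eI.injective (Subtype.ext hc))
    rcases x with ⟨a, x | x⟩ | a <;> rcases y with ⟨b, y | y⟩ | b <;>
      simp only [e1, e2, e3, Sum.elim_inl, Sum.elim_inr, simpleForm, dsum,
        fromBlocks_apply₁₁, fromBlocks_apply₁₂, fromBlocks_apply₂₁, fromBlocks_apply₂₂, sc,
        Matrix.zero_apply]
    · rw [hzero _ _ (hIσ _ _), mul_zero, zero_mul]
      by_cases hab : a = b
      · subst hab
        rw [blockDiagonal'_apply_eq, hBlock_one_inl_inl]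
      · rw [blockDiagonal'_apply_ne _ _ _ hab]
    · by_cases hab : a = b
      · subst hab
        rw [blockDiagonal'_apply_eq, hBlock_one_inl_inr, map_inv₀, hτ, inv_mul_cancel₀ (hσ _),
          one_mul]
      · rw [blockDiagonal'_apply_ne _ _ _ hab, hzero (eI a) (σ (eI b)), mul_zero, zero_mul]
        intro hc
        exact hI b a hab (by rw [← hσσ (eI a), ← hc, hσσ])
    · rw [hzero _ _ (hσK _ _).symm, mul_zero, zero_mul]
    · by_cases hab : a = b
      · subst hab
        rw [blockDiagonal'_apply_eq, hBlock_one_inr_inl, map_one, one_mul, hMij]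
        exact mul_right_comm _ _ _ |>.trans (by rw [mul_inv_cancel₀ (hτ0 _ (hσ _)), one_mul])
      · rw [blockDiagonal'_apply_ne _ _ _ hab, hzero (σ (eI a)) (eI b), mul_zero, zero_mul]
        rw [hσσ]
        exact hI a b (Ne.symm hab)
    · rw [hzero _ _ (by rw [hσσ]; exact (hIσ _ _).symm), mul_zero, zero_mul]
      by_cases hab : a = b
      · subst hab
        rw [blockDiagonal'_apply_eq, hBlock_one_inr_inr]
      · rw [blockDiagonal'_apply_ne _ _ _ hab]
    · rw [hzero _ _ (by rw [hσσ]; exact (hIK _ _).symm), mul_zero, zero_mul]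
    · rw [hzero _ _ (by rw [hfix]; exact hIK _ _), mul_zero, zero_mul]
    · rw [hzero _ _ (by rw [hfix]; exact hσK _ _), mul_zero, zero_mul]
    · by_cases hab : a = b
      · subst hab
        rw [diagonal_apply_eq]
      · rw [diagonal_apply_ne _ hab, hzero (eK a) (eK b), mul_zero, zero_mul]
        rw [hfix]
        exact fun hc => hab (eK.injective (Subtype.ext hc)).symm

/-! ### The pencil as a polynomial -/

section PencilPoly

open Polynomial Topology Filter

variable {τ : ℂ →+* ℂ} {n : ℕ}

/-- The polynomial `det (A - X A')`. -/
def pencilPoly {R : Type*} [CommRing R] (A A' : Matrix (Fin n) (Fin n) R) : R[X] :=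
  ((X : R[X]) • (-A').map C + A.map C).det

/-- Lets the entries be polynomials in the parameter of a line, to be specialised afterwards. -/
theorem pencilPoly_map {R S : Type*} [CommRing R] [CommRing S] (f : R →+* S)
    (A A' : Matrix (Fin n) (Fin n) R) :
    (pencilPoly A A').map f = pencilPoly (A.map f) (A'.map f) := by
  rw [pencilPoly, pencilPoly, ← coe_mapRingHom, RingHom.map_det]
  congr 1
  ext1 i j
  simp

theorem natDegree_pencilPoly_le {R : Type*} [CommRing R] (A A' : Matrix (Fin n) (Fin n) R) :
    (pencilPoly A A').natDegree ≤ n := by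
  simpa [pencilPoly] using natDegree_det_X_add_C_le (-A') A

theorem coeff_pencilPoly {R : Type*} [CommRing R] (A A' : Matrix (Fin n) (Fin n) R) :
    (pencilPoly A A').coeff n = (-A').det := by
  simpa [pencilPoly] using coeff_det_X_add_C_card (-A') A

theorem eval_pencilPoly (A : Matrix (Fin n) (Fin n) ℂ) (z : ℂ) :
    (pencilPoly A (twistTranspose τ A)).eval z = (pencil τ A z).det := by
  rw [pencilPoly, ← coe_evalRingHom, RingHom.map_det]
  congr 1
  ext1 i j
  simp [pencil_apply]
  ring

theorem det_neg_twistTranspose_ne_zero {A : Matrix (Fin n) (Fin n) ℂ} (hA : A.det ≠ 0) :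
    (-twistTranspose τ A).det ≠ 0 := by
  rw [det_neg, det_twistTranspose]
  exact mul_ne_zero (by simp) (by rwa [Ne, map_eq_zero])

theorem natDegree_pencilPoly {A : Matrix (Fin n) (Fin n) ℂ} (hA : A.det ≠ 0) :
    (pencilPoly A (twistTranspose τ A)).natDegree = n :=
  natDegree_eq_of_le_of_coeff_ne_zero (natDegree_pencilPoly_le _ _)
    (by rw [coeff_pencilPoly]; exact det_neg_twistTranspose_ne_zero hA)

theorem leadingCoeff_pencilPoly {A : Matrix (Fin n) (Fin n) ℂ} (hA : A.det ≠ 0) :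
    (pencilPoly A (twistTranspose τ A)).leadingCoeff = (-twistTranspose τ A).det := by
  rw [leadingCoeff, natDegree_pencilPoly hA, coeff_pencilPoly]

theorem pencilPoly_ne_zero {A : Matrix (Fin n) (Fin n) ℂ} (hA : A.det ≠ 0) :
    pencilPoly A (twistTranspose τ A) ≠ 0 := by
  rw [← leadingCoeff_ne_zero, leadingCoeff_pencilPoly hA]
  exact det_neg_twistTranspose_ne_zero hA

theorem mem_roots_pencilPoly {A : Matrix (Fin n) (Fin n) ℂ} (hA : A.det ≠ 0) {z : ℂ} :
    z ∈ (pencilPoly A (twistTranspose τ A)).roots ↔ (pencil τ A z).det = 0 := by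
  rw [mem_roots (pencilPoly_ne_zero hA), IsRoot, eval_pencilPoly]

theorem card_roots_pencilPoly {A : Matrix (Fin n) (Fin n) ℂ} (hA : A.det ≠ 0) :
    (pencilPoly A (twistTranspose τ A)).roots.card = n := by
  rw [← (IsAlgClosed.splits _).natDegree_eq_card_roots, natDegree_pencilPoly hA]

theorem HasSimpleSpectrum.eq_toFinset {A : Matrix (Fin n) (Fin n) ℂ} {s : Finset ℂ}
    (h : HasSimpleSpectrum τ A s) : s = (pencilPoly A (twistTranspose τ A)).roots.toFinset := by
  refine Finset.eq_of_subset_of_card_le (fun z hz => ?_) ?_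
  · rw [Multiset.mem_toFinset, mem_roots_pencilPoly h.1]
    exact h.2.2 z hz
  · rw [h.2.1, Fintype.card_fin]
    exact (Multiset.toFinset_card_le _).trans (card_roots_pencilPoly h.1).le

theorem HasSimpleSpectrum.mem_iff {A : Matrix (Fin n) (Fin n) ℂ} {s : Finset ℂ}
    (h : HasSimpleSpectrum τ A s) {z : ℂ} : z ∈ s ↔ (pencil τ A z).det = 0 := by
  rw [h.eq_toFinset, Multiset.mem_toFinset, mem_roots_pencilPoly h.1]

theorem HasSimpleSpectrum.unique {A : Matrix (Fin n) (Fin n) ℂ} {s s' : Finset ℂ}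
    (h : HasSimpleSpectrum τ A s) (h' : HasSimpleSpectrum τ A s') : s = s' := by
  rw [h.eq_toFinset, h'.eq_toFinset]

theorem exists_hasSimpleSpectrum_iff_separable {A : Matrix (Fin n) (Fin n) ℂ} (hA : A.det ≠ 0) :
    (∃ s, HasSimpleSpectrum τ A s) ↔ (pencilPoly A (twistTranspose τ A)).Separable := by
  rw [← nodup_roots_iff_of_splits (pencilPoly_ne_zero hA) (IsAlgClosed.splits _),
    ← Multiset.toFinset_card_eq_card_iff_nodup, card_roots_pencilPoly hA]
  constructor
  · rintro ⟨s, hs⟩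
    rw [← hs.eq_toFinset, hs.2.1, Fintype.card_fin]
  · intro h
    refine ⟨_, hA, by rwa [Fintype.card_fin], fun z hz => ?_⟩
    rwa [Multiset.mem_toFinset, mem_roots_pencilPoly hA] at hz

/-! ### Density -/

/-- The degrees `n` and `n - 1` are prescribed, so the resultant commutes with specialisation even
where the degree drops. -/
theorem separable_iff_resultant_ne_zero {p : ℂ[X]} (hp : p.natDegree = n) (h0 : p ≠ 0) :
    p.Separable ↔ p.resultant (derivative p) n (n - 1) ≠ 0 := by
  have h := resultant_eq_zero_iff (f := p) (g := derivative p)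
  rw [natDegree_derivative, hp] at h
  rw [Separable, Ne, h]
  simp [h0]

theorem closure_hasSimpleSpectrum (hτ : ∀ x : ℝ, τ x = x) {E : Matrix (Fin n) (Fin n) ℂ}
    {s : Finset ℂ} (hE : HasSimpleSpectrum τ E s) :
    closure {B : Matrix (Fin n) (Fin n) ℂ | ∃ s, HasSimpleSpectrum τ B s} = Set.univ := by
  refine Set.eq_univ_of_forall fun B => ?_
  let T : Matrix (Fin n) (Fin n) ℂ[X] := Matrix.of fun i j => C (B i j) + X * C (E i j - B i j)
  -- For real `t`, `τ` fixes `t`, so the twisted transpose is still polynomial in `t`.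
  let T' : Matrix (Fin n) (Fin n) ℂ[X] :=
    Matrix.of fun i j => C (τ (B j i)) + X * C (τ (E j i - B j i))
  let F : ℝ → Matrix (Fin n) (Fin n) ℂ := fun t => B + (t : ℂ) • (E - B)
  have hT : ∀ t : ℝ, T.map (evalRingHom (t : ℂ)) = F t := fun t => by
    ext i j
    simp [T, F]
  have hT' : ∀ t : ℝ, T'.map (evalRingHom (t : ℂ)) = twistTranspose τ (F t) := fun t => by
    ext i j
    simp [T', F, hτ]
  -- The first factor tests invertibility, which makes the degree exactly `n`; the second then tests
  -- separability.
  let f : ℂ[X] := T.det * (pencilPoly T T').resultant (derivative (pencilPoly T T')) n (n - 1)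
  have hf : ∀ t : ℝ, f.eval (t : ℂ) ≠ 0 ↔ ∃ s, HasSimpleSpectrum τ (F t) s := fun t => by
    have h1 : (T.det).eval (t : ℂ) = (F t).det := by
      rw [← coe_evalRingHom, RingHom.map_det, ← hT]
      rfl
    have h2 : ((pencilPoly T T').resultant (derivative (pencilPoly T T')) n (n - 1)).eval (t : ℂ) =
        (pencilPoly (F t) (twistTranspose τ (F t))).resultant
          (derivative (pencilPoly (F t) (twistTranspose τ (F t)))) n (n - 1) := by
      rw [← coe_evalRingHom, ← resultant_map_map, ← derivative_map, pencilPoly_map, hT, hT']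
    rw [eval_mul, mul_ne_zero_iff, h1, h2]
    constructor
    · rintro ⟨hd, hr⟩
      rw [exists_hasSimpleSpectrum_iff_separable hd,
        separable_iff_resultant_ne_zero (natDegree_pencilPoly hd) (pencilPoly_ne_zero hd)]
      exact hr
    · rintro ⟨s, hs⟩
      refine ⟨hs.1, ?_⟩
      rw [← separable_iff_resultant_ne_zero (natDegree_pencilPoly hs.1) (pencilPoly_ne_zero hs.1),
        ← exists_hasSimpleSpectrum_iff_separable hs.1]
      exact ⟨s, hs⟩
  have hf0 : f ≠ 0 := by
    intro h
    refine (hf 1).2 ⟨s, ?_⟩ (by simp [h])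
    simpa [F] using hE
  have hfin : {t : ℝ | f.eval (t : ℂ) = 0}.Finite := by
    refine Set.Finite.subset (Set.Finite.preimage Complex.ofReal_injective.injOn
      (f.roots.toFinset.finite_toSet)) fun t ht => ?_
    simpa [hf0] using ht
  have hev : ∀ᶠ t in 𝓝[≠] (0 : ℝ), ∃ s, HasSimpleSpectrum τ (F t) s := by
    have hnhds : ({t : ℝ | f.eval (t : ℂ) = 0} \ {0})ᶜ ∈ 𝓝 (0 : ℝ) :=
      (hfin.subset Set.sdiff_subset).isClosed.isOpen_compl.mem_nhds fun h => h.2 rfl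
    filter_upwards [mem_nhdsWithin_of_mem_nhds hnhds, self_mem_nhdsWithin] with t ht ht0
    exact (hf t).1 fun h => ht ⟨h, ht0⟩
  have hF : Tendsto F (𝓝[≠] 0) (𝓝 B) := by
    have : Continuous F := by fun_prop
    simpa [F] using (this.tendsto 0).mono_left nhdsWithin_le_nhds
  exact mem_closure_of_tendsto hF hev

/-! ### Continuity of the spectrum -/

/-- If all zeros were at distance at least `ε` from `z`, the factorisation would bound the value at
`z` below by the leading coefficient times `ε ^ n`. -/
theorem exists_root_norm_sub_lt {A : Matrix (Fin n) (Fin n) ℂ} (hA : A.det ≠ 0) {z : ℂ} {ε : ℝ}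
    (hε : 0 < ε)
    (h : ‖(pencil τ A z).det‖ < ‖(-twistTranspose τ A).det‖ * ε ^ n) :
    ∃ r, (pencil τ A r).det = 0 ∧ ‖r - z‖ < ε := by
  by_contra! hc
  refine h.not_ge ?_
  rw [← eval_pencilPoly, (IsAlgClosed.splits _).eval_eq_prod_roots, leadingCoeff_pencilPoly hA,
    norm_mul]
  gcongr
  have hcard := card_roots_pencilPoly (τ := τ) hA
  have : ∀ r ∈ (pencilPoly A (twistTranspose τ A)).roots, ε ≤ ‖z - r‖ := fun r hr => by
    rw [norm_sub_rev]
    exact hc r ((mem_roots_pencilPoly hA).1 hr)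
  generalize (pencilPoly A (twistTranspose τ A)).roots = R at this hcard ⊢
  rw [← hcard]
  clear hcard
  induction R using Multiset.induction_on with
  | empty => simp
  | cons a R ih =>
    rw [Multiset.card_cons, pow_succ', Multiset.map_cons, Multiset.prod_cons, norm_mul]
    exact mul_le_mul (this a (by simp)) (ih fun r hr => this r (by simp [hr])) (by positivity)
      (norm_nonneg _)

theorem continuous_twistTranspose (hτ : Continuous τ) :
    Continuous fun A : Matrix (Fin n) (Fin n) ℂ => twistTranspose τ A := by
  refine continuous_matrix fun i j => ?_
  simp only [twistTranspose_apply]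
  exact hτ.comp (continuous_id.matrix_elem j i)

theorem eventually_exists_root_mem (hτ : Continuous τ) {A : Matrix (Fin n) (Fin n) ℂ}
    (hA : A.det ≠ 0) {z : ℂ} (hz : (pencil τ A z).det = 0) {W : Set ℂ} (hW : W ∈ 𝓝 z) :
    ∀ᶠ A' in 𝓝 A, ∃ r ∈ W, (pencil τ A' r).det = 0 := by
  obtain ⟨ε, hε, hεW⟩ := Metric.mem_nhds_iff.1 hW
  have hc1 : Continuous fun A' : Matrix (Fin n) (Fin n) ℂ => ‖(pencil τ A' z).det‖ :=
    (Continuous.matrix_det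
      (continuous_id.sub ((continuous_twistTranspose hτ).const_smul z))).norm
  have hc2 : Continuous fun A' : Matrix (Fin n) (Fin n) ℂ =>
      ‖(-twistTranspose τ A').det‖ * ε ^ n :=
    (Continuous.matrix_det (continuous_twistTranspose hτ).neg).norm.mul continuous_const
  have hlt : ‖(pencil τ A z).det‖ < ‖(-twistTranspose τ A).det‖ * ε ^ n := by
    rw [hz, norm_zero]
    exact mul_pos (norm_pos_iff.2 (det_neg_twistTranspose_ne_zero hA)) (pow_pos hε n)
  filter_upwards [hc1.continuousAt.eventually_lt hc2.continuousAt hlt,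
    (continuous_id.matrix_det.continuousAt (x := A)).eventually_ne hA] with A' h1 h2
  obtain ⟨r, hr, hrz⟩ := exists_root_norm_sub_lt h2 hε h1
  exact ⟨r, hεW (by simpa [dist_eq_norm] using hrz), hr⟩

/-- Up to a scalar, the pencil at `(τ z)⁻¹` is the twisted transpose of the pencil at `z`. -/
theorem det_pencil_inv_eq_zero (hτ : ∀ x, τ (τ x) = x) {A : Matrix (Fin n) (Fin n) ℂ} {z : ℂ}
    (hz0 : z ≠ 0) (hz : (pencil τ A z).det = 0) : (pencil τ A (τ z)⁻¹).det = 0 := by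
  have hτz : τ z ≠ 0 := by rwa [Ne, map_eq_zero]
  have : pencil τ A (τ z)⁻¹ = (-(τ z)⁻¹) • twistTranspose τ (pencil τ A z) := by
    ext i j
    simp only [pencil_apply, Matrix.smul_apply, twistTranspose_apply, smul_eq_mul, map_sub, map_mul,
      hτ]
    field_simp
    ring
  rw [this, det_smul, det_twistTranspose, hz, map_zero, mul_zero]

/-- The matrices with simple spectrum, `2ℓ` points of which are off the unit circle. -/
def simpleSpectrumStratum (n ℓ : ℕ) : Set (Matrix (Fin n) (Fin n) ℂ) :=
  {B | ∃ s, HasSimpleSpectrum (starRingEnd ℂ) B s ∧ (s.filter fun z => ‖z‖ ≠ 1).card = 2 * ℓ}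

theorem isOpen_simpleSpectrumStratum (n ℓ : ℕ) : IsOpen (simpleSpectrumStratum n ℓ) := by
  classical
  rw [isOpen_iff_mem_nhds]
  rintro B ⟨s, hs, hℓ⟩
  obtain ⟨U, hU, hdisj⟩ := s.finite_toSet.t2_separation
  -- Near a zero on the circle, `W z` also keeps the reflected point in `U z`; near any other zero
  -- it avoids the circle.
  let W : ℂ → Set ℂ := fun z =>
    U z ∩ if ‖z‖ = 1 then {w | w ≠ 0 ∧ (starRingEnd ℂ w)⁻¹ ∈ U z} else {w | ‖w‖ ≠ 1}
  have hW : ∀ z, W z ∈ 𝓝 z := by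
    intro z
    refine inter_mem ((hU z).2.mem_nhds (hU z).1) ?_
    split_ifs with h
    · have hz : z ≠ 0 := by
        rintro rfl
        simp at h
      have hinv : (starRingEnd ℂ z)⁻¹ = z := by
        rw [← Complex.inv_eq_conj h, inv_inv]
      have hcont : ContinuousAt (fun w : ℂ => (starRingEnd ℂ w)⁻¹) z :=
        Complex.continuous_conj.continuousAt.inv₀ (by simpa using hz)
      have hmem : U z ∈ 𝓝 ((starRingEnd ℂ z)⁻¹) := by
        rw [hinv]
        exact (hU z).2.mem_nhds (hU z).1
      exact inter_mem (isOpen_ne.mem_nhds hz) (hcont hmem)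
    · exact (isOpen_ne_fun continuous_norm continuous_const).mem_nhds h
  have hev : ∀ᶠ B' in 𝓝 B, ∀ z ∈ s, ∃ r ∈ W z, (pencil (starRingEnd ℂ) B' r).det = 0 :=
    (Filter.eventually_all_finset s).2 fun z hz =>
      eventually_exists_root_mem Complex.continuous_conj hs.1 (hs.2.2 z hz) (hW z)
  filter_upwards [hev, (continuous_id.matrix_det.continuousAt (x := B)).eventually_ne hs.1]
    with B' h1 h2
  choose! r hrW hr using h1
  have hrinj : Set.InjOn r s := fun z hz w hw hzw => by
    by_contra hne
    exact Set.disjoint_left.1 (hdisj hz hw hne) (hrW z hz).1 (hzw ▸ (hrW w hw).1)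
  have hs' : HasSimpleSpectrum (starRingEnd ℂ) B' (s.image r) := by
    refine ⟨h2, by rw [Finset.card_image_of_injOn hrinj, hs.2.1], fun z hz => ?_⟩
    obtain ⟨w, hw, rfl⟩ := Finset.mem_image.1 hz
    exact hr w hw
  have hnorm : ∀ z ∈ s, (‖r z‖ ≠ 1 ↔ ‖z‖ ≠ 1) := fun z hz => by
    have hm := (hrW z hz).2
    by_cases hz1 : ‖z‖ = 1
    · simp only [hz1, if_true, Set.mem_ofPred_eq] at hm
      -- The reflection of `r z` is again a zero and lies in `U z`, which contains only the zero `r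
      -- z`; so `r z` is on the circle.
      have hmem := hs'.mem_iff.2 (det_pencil_inv_eq_zero Complex.conj_conj hm.1 (hr z hz))
      obtain ⟨w, hw, hwz⟩ := Finset.mem_image.1 hmem
      have hwz' : w = z := by
        by_contra hne
        exact Set.disjoint_left.1 (hdisj hw hz hne) (hrW w hw).1 (hwz ▸ hm.2)
      rw [hwz'] at hwz
      have h3 := congrArg norm hwz
      rw [norm_inv, RCLike.norm_conj] at h3
      have h4 : 0 < ‖r z‖ := norm_pos_iff.2 hm.1
      have h5 : ‖r z‖ = 1 := by
        have : ‖r z‖ * ‖r z‖ = 1 := by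
          nth_rw 2 [h3]
          exact mul_inv_cancel₀ h4.ne'
        nlinarith
      simp [hz1, h5]
    · simp only [hz1, if_false, Set.mem_ofPred_eq] at hm
      simp [hz1, hm]
  refine ⟨_, hs', ?_⟩
  rw [Finset.filter_image, Finset.card_image_of_injOn
    (hrinj.mono fun z hz => (Finset.mem_filter.1 hz).1), ← hℓ]
  congr 1
  exact Finset.filter_congr fun z hz => hnorm z hz

theorem eq_of_mem_simpleSpectrumStratum {ℓ ℓ' : ℕ} {B : Matrix (Fin n) (Fin n) ℂ}
    (h : B ∈ simpleSpectrumStratum n ℓ) (h' : B ∈ simpleSpectrumStratum n ℓ') : ℓ = ℓ' := by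
  obtain ⟨s, hs, hℓ⟩ := h
  obtain ⟨s', hs', hℓ'⟩ := h'
  rw [hs.unique hs'] at hℓ
  omega

theorem closure_simpleSpectrumStratum_inter {ℓ ℓ' : ℕ} (h : ℓ ≠ ℓ') :
    closure (simpleSpectrumStratum n ℓ) ∩ simpleSpectrumStratum n ℓ' = ∅ := by
  have : Disjoint (simpleSpectrumStratum n ℓ) (simpleSpectrumStratum n ℓ') :=
    Set.disjoint_left.2 fun B hB hB' => h (eq_of_mem_simpleSpectrumStratum hB hB')
  exact (this.closure_left (isOpen_simpleSpectrumStratum n ℓ')).inter_eq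

end PencilPoly

/-! ### The generic bundles in terms of spectra -/

section Shapes

variable {τ : ℂ →+* ℂ} {ℓ t : ℕ}

theorem TwistCongruent.of_eq_submatrix {m k k' : Type*} [Fintype m] [DecidableEq m]
    {A : Matrix m m ℂ} {B : Matrix k k ℂ} {B' : Matrix k' k' ℂ} (h : TwistCongruent τ A B)
    (E : k ≃ k') (hB : B = B'.submatrix E E) : TwistCongruent τ A B' := by
  obtain ⟨e, P, hP, rfl⟩ := h
  exact ⟨e.trans E, P, hP, by rw [hB]; rfl⟩

theorem genericMatrix_twistCongruent (n ℓ : ℕ) (h : ℓ ≤ n / 2) (μ : Fin ℓ → ℂ)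
    (α : Fin (n - 2 * ℓ) → ℂ) : TwistCongruent τ (genericMatrix n ℓ h μ α) (simpleForm μ α) :=
  ⟨genericEquiv n ℓ h, 1, isUnit_one, by
    rw [twistTranspose_one, Matrix.one_mul, Matrix.mul_one]; rfl⟩

/-- The shape of `⨁ α_j ⊕ ⨁ H_2(μ_i)`, with `ℓ` numbers `μ_i` and `t` numbers `α_j`. -/
def simpleStarShape (ℓ t : ℕ) : StarShape where
  n₁ := 0
  n₂ := t
  n₃ := ℓ
  k := fun _ => 1
  l := fun _ => 1
  m := fun _ => 1
  k_pos := fun _ => one_pos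
  l_pos := fun _ => one_pos
  m_pos := fun _ => one_pos

/-- The shape of `⨁ Γ_1 ⊕ ⨁ H_2(μ_i)`, with `ℓ` numbers `μ_i` and `t` blocks `Γ_1`. -/
def simpleCongruenceShape (ℓ t : ℕ) : CongruenceShape where
  n₁ := 0
  n₂ := t
  n₃ := ℓ
  n₄ := 0
  k := fun _ => 1
  l := fun _ => 1
  m := fun _ => 1
  p := fun _ => 1
  k_pos := fun _ => one_pos
  l_pos := fun _ => one_pos
  m_pos := fun _ => one_pos
  p_pos := fun _ => one_pos

/-- The reordering of the blocks of `simpleForm` into those of a canonical form. -/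
def simpleStarEquiv (ℓ t : ℕ) :
    (Σ _ : Fin ℓ, Fin 1 ⊕ Fin 1) ⊕ Fin t ≃ (simpleStarShape ℓ t).Idx where
  toFun := Sum.elim (fun p => .inr p) fun b => .inl (.inr ⟨b, (0 : Fin 1)⟩)
  invFun := Sum.elim (Sum.elim (fun p => p.1.elim0) fun b => .inr b.1) fun p => .inl p
  left_inv := by rintro (p | b) <;> rfl
  right_inv := by
    rintro ((⟨j, -⟩ | ⟨b, x⟩) | p)
    · exact j.elim0
    · rw [show x = (0 : Fin 1) from Subsingleton.elim (α := Fin 1) _ _]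
      rfl
    · rfl

/-- The reordering of the blocks of `simpleForm` into those of a canonical form. -/
def simpleCongruenceEquiv (ℓ t : ℕ) :
    (Σ _ : Fin ℓ, Fin 1 ⊕ Fin 1) ⊕ Fin t ≃ (simpleCongruenceShape ℓ t).Idx where
  toFun := Sum.elim (fun p => .inr (.inl p)) fun b => .inl (.inr ⟨b, (0 : Fin 1)⟩)
  invFun := Sum.elim (Sum.elim (fun p => p.1.elim0) fun b => .inr b.1)
    (Sum.elim (fun p => .inl p) fun p => p.1.elim0)
  left_inv := by rintro (p | b) <;> rfl
  right_inv := by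
    rintro ((⟨j, -⟩ | ⟨b, x⟩) | p | ⟨j, -⟩)
    · exact j.elim0
    · rw [show x = (0 : Fin 1) from Subsingleton.elim (α := Fin 1) _ _]
      rfl
    · rfl
    · exact j.elim0

theorem gammaBlock_one_apply (x y : Fin 1) : gammaBlock 1 x y = 1 := by
  simp [gammaBlock]

theorem blockDiagonal'_fin_one_apply {t : ℕ} (D : Fin t → Matrix (Fin 1) (Fin 1) ℂ) (a b : Fin t) :
    blockDiagonal' D ⟨a, 0⟩ ⟨b, 0⟩ = diagonal (fun j => D j 0 0) a b := by
  by_cases h : a = b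
  · subst h
    rw [blockDiagonal'_apply_eq, diagonal_apply_eq]
  · rw [blockDiagonal'_apply_ne _ _ _ h, diagonal_apply_ne _ h]

theorem simpleForm_eq_starShape_form (μ : Fin ℓ → ℂ) (c : Fin t → ℂ) :
    simpleForm μ c =
      ((simpleStarShape ℓ t).form c μ).submatrix (simpleStarEquiv ℓ t) (simpleStarEquiv ℓ t) := by
  ext (p | a) (q | b)
  · rfl
  · rfl
  · rfl
  · refine Eq.trans ?_ (blockDiagonal'_fin_one_apply (fun j => c j • gammaBlock 1) a b).symm
    simp [simpleForm, dsum, gammaBlock_one_apply]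

theorem simpleForm_eq_congruenceShape_form (μ : Fin ℓ → ℂ) :
    simpleForm μ (fun _ : Fin t => 1) =
      ((simpleCongruenceShape ℓ t).form μ).submatrix (simpleCongruenceEquiv ℓ t)
        (simpleCongruenceEquiv ℓ t) := by
  ext (p | a) (q | b)
  · rfl
  · rfl
  · rfl
  · refine Eq.trans ?_ (blockDiagonal'_fin_one_apply (fun _ => gammaBlock 1) a b).symm
    simp [simpleForm, dsum, gammaBlock_one_apply]

end Shapes

theorem exists_twistCongruent_simpleForm_star {n : ℕ} {B : Matrix (Fin n) (Fin n) ℂ}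
    {s : Finset ℂ} (h : HasSimpleSpectrum (starRingEnd ℂ) B s) :
    ∃ (ℓ t : ℕ) (μ : Fin ℓ → ℂ) (c : Fin t → ℂ), GenericStarParams μ c ∧
      TwistCongruent (starRingEnd ℂ) B (simpleForm μ c) := by
  have hadm : ∀ z : ℂ, z ≠ 0 → z * starRingEnd ℂ z ≠ 1 → 1 < ‖z‖ ∨ 1 < ‖(starRingEnd ℂ z)⁻¹‖ := by
    intro z hz0 hz
    rcases lt_trichotomy 1 ‖z‖ with h1 | h1 | h1
    · exact .inl h1
    · rw [Complex.mul_conj, Complex.normSq_eq_norm_sq, ← h1] at hz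
      simp at hz
    · right
      rw [norm_inv, RCLike.norm_conj]
      exact (one_lt_inv₀ (norm_pos_iff.2 hz0)).2 h1
  have hadm' : ∀ z w : ℂ, 1 < ‖z‖ → 1 < ‖w‖ → w * starRingEnd ℂ z ≠ 1 := by
    intro z w hz hw h
    have := congrArg norm h
    rw [norm_mul, RCLike.norm_conj, norm_one] at this
    nlinarith
  have hN : ∀ c : ℂ, c ≠ 0 → ∃ d, d ≠ 0 ∧ ‖starRingEnd ℂ d * c * d‖ = 1 := by
    intro c hc
    have h0 : 0 < ‖c‖ := norm_pos_iff.2 hc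
    have hs : 0 < √‖c‖ := Real.sqrt_pos.2 h0
    -- A real `d` makes `τ(d) c d` equal to `c / ‖c‖`.
    refine ⟨((√‖c‖)⁻¹ : ℝ), by simpa using hc, ?_⟩
    rw [Complex.conj_ofReal, norm_mul, norm_mul, Complex.norm_real,
      Real.norm_of_nonneg (by positivity)]
    field_simp
    exact (Real.sq_sqrt h0.le).symm
  obtain ⟨ℓ, t, μ, c, hμ, hμi, hc, hci, hB⟩ := h.exists_twistCongruent Complex.conj_conj
    (adm := fun z => 1 < ‖z‖) (N := fun c => ‖c‖ = 1) hadm hadm' hN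
  refine ⟨ℓ, t, μ, c, ⟨hμ, hμi, hc, fun i j hij hsq => hci i j hij ?_⟩, hB⟩
  rw [← Complex.inv_eq_conj (hc i), ← Complex.inv_eq_conj (hc j)]
  have hi : c i ≠ 0 := norm_ne_zero_iff.1 (by rw [hc]; exact one_ne_zero)
  have hj : c j ≠ 0 := norm_ne_zero_iff.1 (by rw [hc]; exact one_ne_zero)
  field_simp
  exact hsq

theorem congruenceParam_or_inv {z : ℂ} (hz0 : z ≠ 0) (hz : z * z ≠ 1) :
    CongruenceParam z ∨ CongruenceParam z⁻¹ := by
  rw [congruenceParam_iff, congruenceParam_iff, norm_inv]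
  rcases lt_trichotomy 1 ‖z‖ with h1 | h1 | h1
  · exact .inl (.inl h1)
  · rcases lt_trichotomy 0 z.im with h2 | h2 | h2
    · exact .inl (.inr ⟨h1.symm, h2⟩)
    · refine absurd ?_ hz
      have hc : starRingEnd ℂ z = z := Complex.conj_eq_iff_im.2 h2.symm
      nth_rw 2 [← hc]
      rw [Complex.mul_conj, Complex.normSq_eq_norm_sq, ← h1]
      simp
    · refine .inr (.inr ⟨by rw [← h1, inv_one], ?_⟩)
      rw [Complex.inv_eq_conj h1.symm, Complex.conj_im]
      linarith
  · exact .inr (.inl ((one_lt_inv₀ (norm_pos_iff.2 hz0)).2 h1))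

theorem exists_twistCongruent_simpleForm_id {n : ℕ} {B : Matrix (Fin n) (Fin n) ℂ}
    {s : Finset ℂ} (h : HasSimpleSpectrum (RingHom.id ℂ) B s) :
    ∃ (ℓ t : ℕ) (μ : Fin ℓ → ℂ), t ≤ 1 ∧ GenericParams μ ∧
      TwistCongruent (RingHom.id ℂ) B (simpleForm μ fun _ : Fin t => 1) := by
  have hN : ∀ c : ℂ, c ≠ 0 → ∃ d, d ≠ 0 ∧ RingHom.id ℂ d * c * d = 1 := by
    intro c hc
    obtain ⟨d, hd⟩ := IsAlgClosed.exists_pow_nat_eq c⁻¹ (n := 2) two_pos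
    refine ⟨d, ?_, ?_⟩
    · rintro rfl
      exact inv_ne_zero hc (by simpa using hd.symm)
    · rw [RingHom.id_apply, show d * c * d = d ^ 2 * c by ring, hd, inv_mul_cancel₀ hc]
  obtain ⟨ℓ, t, μ, c, hμ, hμi, hc, hci, hB⟩ := h.exists_twistCongruent (fun _ => rfl)
    (adm := CongruenceParam) (N := fun c => c = 1) (fun _ => congruenceParam_or_inv)
    (fun z w hz hw => hw.mul_ne_one hz) hN
  obtain rfl : c = fun _ => 1 := funext hc
  refine ⟨ℓ, t, μ, ?_, ⟨hμ, hμi⟩, hB⟩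
  by_contra! ht
  -- All `c_i` are `1`, so two indices would contradict their distinctness condition.
  exact hci ⟨0, by omega⟩ ⟨1, ht⟩ (by simp) rfl

theorem card_eq_of_twistCongruent_simpleForm {τ : ℂ →+* ℂ} {n ℓ t : ℕ}
    {B : Matrix (Fin n) (Fin n) ℂ} {μ : Fin ℓ → ℂ} {c : Fin t → ℂ}
    (h : TwistCongruent τ B (simpleForm μ c)) : n = 2 * ℓ + t := by
  simpa [mul_comm] using Fintype.card_congr h.choose

theorem GenericStarParams.mem_simpleSpectrumStratum {n ℓ t : ℕ} {B : Matrix (Fin n) (Fin n) ℂ}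
    {μ : Fin ℓ → ℂ} {c : Fin t → ℂ} (hp : GenericStarParams μ c)
    (h : TwistCongruent (starRingEnd ℂ) B (simpleForm μ c)) : B ∈ simpleSpectrumStratum n ℓ := by
  obtain ⟨s, hs, hc⟩ := (simpleStarShape ℓ t).exists_hasSimpleSpectrum (α := c) (μ := μ) hp.2.2.1
    hp.1 rfl (fun _ => rfl) (fun _ => rfl) hp.2.2.2 hp.2.1
  exact ⟨s, ((h.of_eq_submatrix _ (simpleForm_eq_starShape_form μ c)).hasSimpleSpectrum_iff
    Complex.conj_conj).2 hs, hc⟩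

theorem GenericParams.exists_hasSimpleSpectrum {n ℓ t : ℕ} (ht : t ≤ 1)
    {B : Matrix (Fin n) (Fin n) ℂ} {μ : Fin ℓ → ℂ} (hp : GenericParams μ)
    (h : TwistCongruent (RingHom.id ℂ) B (simpleForm μ fun _ : Fin t => 1)) :
    ∃ s, HasSimpleSpectrum (RingHom.id ℂ) B s := by
  obtain ⟨s, hs⟩ := (simpleCongruenceShape ℓ t).exists_hasSimpleSpectrum (μ := μ) hp.1 rfl ht rfl
    (fun _ => rfl) (fun _ => rfl) hp.2
  exact ⟨s, ((h.of_eq_submatrix _ (simpleForm_eq_congruenceShape_form μ)).hasSimpleSpectrum_iff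
    fun _ => rfl).2 hs⟩

theorem ne_iff_ne_of_injective {ι : Type*} {f g : ι → ℂ} (hf : ∀ i j, i ≠ j → f i ≠ f j)
    (hg : ∀ i j, i ≠ j → g i ≠ g j) (i j : ι) : f i ≠ f j ↔ g i ≠ g j := by
  by_cases h : i = j
  · simp [h]
  · exact iff_of_true (hf i j h) (hg i j h)

theorem genericStarBundle_eq {n : ℕ} (ℓ : Fin (n / 2 + 1)) {μ : Fin (ℓ : ℕ) → ℂ}
    {α : Fin (n - 2 * (ℓ : ℕ)) → ℂ} (hp : GenericStarParams μ α) :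
    genericStarBundle n ℓ μ α = simpleSpectrumStratum n ℓ := by
  have hA := genericMatrix_twistCongruent (τ := starRingEnd ℂ) n ℓ (Nat.lt_succ_iff.mp ℓ.isLt) μ α
  ext B
  constructor
  · rintro ⟨S, a, m, ha, hm, hAS, a', m', ha', hm', hpar, -, hmm, hBS⟩
    obtain ⟨s, hs, hsℓ⟩ := hp.mem_simpleSpectrumStratum hA
    have hs' := (starCongruent_iff_twistCongruent.1 hAS).hasSimpleSpectrum_iff
      Complex.conj_conj |>.1 hs
    obtain ⟨h1, hl, hm1, hai, hmi⟩ := S.eq_one_of_hasSimpleSpectrum ha hm hs'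
    obtain ⟨s₁, hs₁, hc₁⟩ := S.exists_hasSimpleSpectrum ha hm h1 hl hm1 hai hmi
    obtain ⟨s₂, hs₂, hc₂⟩ := S.exists_hasSimpleSpectrum ha' hm' h1 hl hm1
      (fun i j hij => (hpar i j (by rw [hl, hl])).2 (hai i j hij))
      (fun i j hij => (hmm i j).2 (hmi i j hij))
    have hs₁A := (starCongruent_iff_twistCongruent.1 hAS).hasSimpleSpectrum_iff
      Complex.conj_conj |>.2 hs₁
    -- Counting zeros off the circle identifies the number of `H_2` blocks in an arbitrary canonical
    -- form of the generating matrix.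
    have hℓ : 2 * S.n₃ = 2 * (ℓ : ℕ) := by rw [← hc₁, ← hsℓ, hs.unique hs₁A]
    exact ⟨s₂, (starCongruent_iff_twistCongruent.1 hBS).hasSimpleSpectrum_iff
      Complex.conj_conj |>.2 hs₂, hc₂.trans hℓ⟩
  · intro hB
    obtain ⟨s, hs, -⟩ := id hB
    obtain ⟨ℓ', t, μ', c, hp', hBc⟩ := exists_twistCongruent_simpleForm_star hs
    obtain rfl : ℓ' = ℓ :=
      eq_of_mem_simpleSpectrumStratum (hp'.mem_simpleSpectrumStratum hBc) hB
    obtain rfl : t = n - 2 * (ℓ : ℕ) := by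
      have := card_eq_of_twistCongruent_simpleForm hBc
      omega
    exact ⟨simpleStarShape ℓ (n - 2 * ℓ), α, μ, hp.2.2.1, hp.1,
      hA.of_eq_submatrix _ (simpleForm_eq_starShape_form μ α), c, μ', hp'.2.2.1, hp'.1,
      fun i j _ => ne_iff_ne_of_injective hp'.2.2.2 hp.2.2.2 i j, fun i j h => absurd rfl h,
      ne_iff_ne_of_injective hp'.2.1 hp.2.1,
      hBc.of_eq_submatrix _ (simpleForm_eq_starShape_form μ' c)⟩

theorem genericBundle_eq {n : ℕ} {μ : Fin (n / 2) → ℂ} (hp : GenericParams μ) :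
    genericBundle n μ = {B | ∃ s, HasSimpleSpectrum (RingHom.id ℂ) B s} := by
  have hA := genericMatrix_twistCongruent (τ := RingHom.id ℂ) n (n / 2) le_rfl μ fun _ => 1
  ext B
  constructor
  · rintro ⟨S, m, hm, hAS, m', hm', hmm, hBS⟩
    obtain ⟨s, hs⟩ := hp.exists_hasSimpleSpectrum (by omega) hA
    have hs' := (congruent_iff_twistCongruent.1 hAS).hasSimpleSpectrum_iff (fun _ => rfl) |>.1 hs
    obtain ⟨h1, h2, h4, hl, hm1, hmi⟩ := S.eq_one_of_hasSimpleSpectrum hm hs'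
    obtain ⟨s₂, hs₂⟩ := S.exists_hasSimpleSpectrum hm' h1 h2 h4 hl hm1
      fun i j hij => (hmm i j).2 (hmi i j hij)
    exact ⟨s₂, (congruent_iff_twistCongruent.1 hBS).hasSimpleSpectrum_iff (fun _ => rfl) |>.2 hs₂⟩
  · rintro ⟨s, hs⟩
    obtain ⟨ℓ', t, μ', ht, hp', hBc⟩ := exists_twistCongruent_simpleForm_id hs
    have hcard := card_eq_of_twistCongruent_simpleForm hBc
    obtain rfl : ℓ' = n / 2 := by omega
    obtain rfl : t = n - 2 * (n / 2) := by omega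
    exact ⟨simpleCongruenceShape (n / 2) (n - 2 * (n / 2)), μ, hp.1,
      hA.of_eq_submatrix _ (simpleForm_eq_congruenceShape_form μ), μ', hp'.1,
      ne_iff_ne_of_injective hp'.2 hp.2,
      hBc.of_eq_submatrix _ (simpleForm_eq_congruenceShape_form μ')⟩

/-- `E` only serves as the endpoint with simple spectrum in the density argument; closure commutes
with the finite union. -/
theorem iUnion_closure_simpleSpectrumStratum {n ℓ : ℕ} {E : Matrix (Fin n) (Fin n) ℂ}
    (hE : E ∈ simpleSpectrumStratum n ℓ) :
    ⋃ ℓ : Fin (n / 2 + 1), closure (simpleSpectrumStratum n ℓ) = Set.univ := by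
  obtain ⟨s, hs, -⟩ := hE
  rw [← closure_iUnion_of_finite, Set.eq_univ_iff_forall]
  intro B
  have hB : B ∈ closure {B | ∃ s, HasSimpleSpectrum (starRingEnd ℂ) B s} := by
    rw [closure_hasSimpleSpectrum Complex.conj_ofReal hs]
    trivial
  refine closure_mono ?_ hB
  rintro B ⟨s, hs⟩
  obtain ⟨ℓ, t, μ, c, hp, hBc⟩ := exists_twistCongruent_simpleForm_star hs
  have hcard := card_eq_of_twistCongruent_simpleForm hBc
  exact Set.mem_iUnion.2 ⟨⟨ℓ, by omega⟩, hp.mem_simpleSpectrumStratum hBc⟩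

end CongruenceCFC

end

/-! ### Assembly of the theorem -/

theorem mainTheorem1 (n : ℕ) (hn : 1 ≤ n) :
    -- (a): density, and independence of the choice of the parameters
    ((∀ μ : Fin (n / 2) → ℂ, CongruenceCFC.GenericParams μ →
        closure (CongruenceCFC.genericBundle n μ) = Set.univ) ∧
      (∀ μ ν : Fin (n / 2) → ℂ, CongruenceCFC.GenericParams μ → CongruenceCFC.GenericParams ν →
        CongruenceCFC.genericBundle n μ = CongruenceCFC.genericBundle n ν)) ∧
    -- (b): independence of the choice of the parameters
    (∀ (ℓ : Fin (n / 2 + 1)) (μ ν : Fin (ℓ : ℕ) → ℂ) (α β : Fin (n - 2 * (ℓ : ℕ)) → ℂ),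
      CongruenceCFC.GenericStarParams μ α → CongruenceCFC.GenericStarParams ν β →
        CongruenceCFC.genericStarBundle n ℓ μ α = CongruenceCFC.genericStarBundle n ℓ ν β) ∧
    (∀ (μ : (ℓ : Fin (n / 2 + 1)) → Fin (ℓ : ℕ) → ℂ)
        (α : (ℓ : Fin (n / 2 + 1)) → Fin (n - 2 * (ℓ : ℕ)) → ℂ),
      (∀ ℓ, CongruenceCFC.GenericStarParams (μ ℓ) (α ℓ)) →
        -- (b1)
        (Set.univ = ⋃ ℓ, closure (CongruenceCFC.genericStarBundle n ℓ (μ ℓ) (α ℓ))) ∧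
        -- (b2)
        (∀ ℓ₁ ℓ₂, ℓ₁ ≠ ℓ₂ →
          closure (CongruenceCFC.genericStarBundle n ℓ₁ (μ ℓ₁) (α ℓ₁)) ∩
            CongruenceCFC.genericStarBundle n ℓ₂ (μ ℓ₂) (α ℓ₂) = ∅) ∧
        -- the closures are pairwise different
        (∀ ℓ₁ ℓ₂, ℓ₁ ≠ ℓ₂ →
          closure (CongruenceCFC.genericStarBundle n ℓ₁ (μ ℓ₁) (α ℓ₁)) ≠
            closure (CongruenceCFC.genericStarBundle n ℓ₂ (μ ℓ₂) (α ℓ₂)))) := by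
  -- The generating matrix itself lies in its stratum; nonemptiness gives the endpoint for density
  -- and separates the closures.
  have hne : ∀ (ℓ : Fin (n / 2 + 1)) {μ : Fin (ℓ : ℕ) → ℂ} {α : Fin (n - 2 * (ℓ : ℕ)) → ℂ},
      CongruenceCFC.GenericStarParams μ α →
        (CongruenceCFC.simpleSpectrumStratum n ℓ).Nonempty := fun ℓ μ α hp =>
    ⟨_, hp.mem_simpleSpectrumStratum
      (CongruenceCFC.genericMatrix_twistCongruent n ℓ (Nat.lt_succ_iff.mp ℓ.isLt) μ α)⟩
  refine ⟨⟨fun μ hμ => ?_, fun μ ν hμ hν => ?_⟩, fun ℓ μ ν α β hα hβ => ?_, fun μ α hp => ?_⟩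
  · obtain ⟨s, hs⟩ := hμ.exists_hasSimpleSpectrum (by omega)
      (CongruenceCFC.genericMatrix_twistCongruent n (n / 2) le_rfl μ fun _ => 1)
    rw [CongruenceCFC.genericBundle_eq hμ]
    exact CongruenceCFC.closure_hasSimpleSpectrum (fun _ => rfl) hs
  · rw [CongruenceCFC.genericBundle_eq hμ, CongruenceCFC.genericBundle_eq hν]
  · rw [CongruenceCFC.genericStarBundle_eq ℓ hα, CongruenceCFC.genericStarBundle_eq ℓ hβ]
  · simp only [fun ℓ => CongruenceCFC.genericStarBundle_eq ℓ (hp ℓ)]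
    have hdisj : ∀ ℓ₁ ℓ₂ : Fin (n / 2 + 1), ℓ₁ ≠ ℓ₂ →
        closure (CongruenceCFC.simpleSpectrumStratum n ℓ₁) ∩
          CongruenceCFC.simpleSpectrumStratum n ℓ₂ = ∅ := fun ℓ₁ ℓ₂ h =>
      CongruenceCFC.closure_simpleSpectrumStratum_inter fun e => h (Fin.ext e)
    refine ⟨?_, hdisj, fun ℓ₁ ℓ₂ h heq => ?_⟩
    · obtain ⟨E, hE⟩ := hne 0 (hp 0)
      exact (CongruenceCFC.iUnion_closure_simpleSpectrumStratum hE).symm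
    · obtain ⟨E, hE⟩ := hne ℓ₂ (hp ℓ₂)
      have hmem : E ∈ closure (CongruenceCFC.simpleSpectrumStratum n ℓ₁) ∩
          CongruenceCFC.simpleSpectrumStratum n ℓ₂ := ⟨heq ▸ subset_closure hE, hE⟩
      rw [hdisj ℓ₁ ℓ₂ h] at hmem
      exact hmem
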